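/- **Setting.** Let $G=(V,E)$ be a connected graph with $n$ vertices and diameter $D$, whose vertices have distinct identifiers below $n^{O(1)}$. Let $T$ be a BFS tree of $G$ rooted at $s$, with tree paths $\pi(s,v)$ and subtrees $T_v$. Every non-leaf vertex has one *heavy* child, a child whose subtree has the most vertices (ties broken arbitrarily); its other children are *light*. Let $\mathsf{LD}(x)$ be the set of vertices in the subtrees of the light children of $x$. Let $V_x=V(T_x)\setminus\{x\}$ and let $\mathcal C_x$ be the set of connected components of $G[V_x]$. For all $x\ne s$ and $C\in\mathcal C_x$ an edge $(u_C,v_C)$ of $G$ with $v_C\in C$ and $x\notin\pi(s,u_C)$ is fixed (such edges exist if $G$ has no cut vertex), and $\pi_x(s,C)=\pi(s,u_C)\circ(u_C,v_C)$. Vertices $x,y$ are *independent* if neither is an ancestor of the other in $T$. For such $x,y$ let $\mathsf{LDS}(x,y)=\{v\in\mathsf{LD}(x)\mid y\in\pi_x(s,C_{x,v})\}$, where $C_{x,v}$ is the component in $\mathcal C_x$ that contains $v$. Communication is synchronous, with messages of $O(\log n)$ bits along the edges of $G$. We write $\widetilde O(f)$ for at most $a\,f\,(\log n)^a$ with a constant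 $a$. **The algorithms.** Let $Q\subseteq V\times V$ be a set of independent pairs, and for $(x,y)\in Q$ let $\Pi_{x,y}$ be an $x$-$y$ path in $G$. For $(x,y)\in Q$ let $\mathcal A^P_{x,y}$ be a randomized algorithm, meant to decide whether $G\setminus\{x,y\}$ is connected, that for all outcomes of its random bits runs for $\widetilde O(D)$ rounds, exchanges $\widetilde O(1)$ messages through each edge, and sends messages only along the edges of $\Pi_{x,y}$ and the edges incident to $\mathsf{LDS}(x,y)\cup\mathsf{LDS}(y,x)$. Its random bits may be shared or private, and each vertex may have any initial information. A vertex is *involved* in $\mathcal A^P_{x,y}$ if it is an endpoint of at least one of these edges. **Promise.** Each path $\Pi_{x,y}$, $(x,y)\in Q$, has length $O(D)$, and each edge of $G$ lies on $\widetilde O(D)$ of these paths. **Statement.** For all constants in the hypotheses and every constant $k$ there is a randomized distributed algorithm $\mathcal S$, the same for all graphs and at all vertices, that runs all $\mathcal A^P_{x,y}$, $(x,y)\in Q$, simultaneously in $\widetilde O(D)$ rounds with messages of $O(\log n)$ bits, whenever the promise holds. In $\mathcal S$, each vertex initially knows only $n$, the depth of $T$, its identifier, the identifiers of its neighbours and of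 its parent in $T$, private random bits, and, for the pairs $(x,y)\in Q$ in whose algorithm it is involved, the identifiers of $x$ and $y$, the number of rounds of $\mathcal A^P_{x,y}$ and its own program in $\mathcal A^P_{x,y}$ (with its own inputs and random bits). For every outcome of the random bits of the algorithms $\mathcal A^P_{x,y}$, with probability at least $1-n^{-k}$ over the random bits of $\mathcal S$, the following holds for all $(x,y)\in Q$: every vertex involved in $\mathcal A^P_{x,y}$ obtains the output that it has when $\mathcal A^P_{x,y}$ runs alone with the same random bits. In particular, if for each $(x,y)\in Q$ the algorithm $\mathcal A^P_{x,y}$, run alone, lets $x$ and $y$ both learn whether $G\setminus\{x,y\}$ is connected with probability at least $1-n^{-(k+2)}$, then with probability at least $1-n^{-k}$ the simultaneous run lets $x$ and $y$ learn this for all $(x,y)\in Q$. -/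

import Mathlib

noncomputable section

open scoped Classical

namespace CutPairs

/-! ### Asymptotics and probability -/

/-- The factor that stands for `log n` in all bounds: `⌊log₂ n⌋ + 1`, the number of bits of `n`. -/
def lg (n : ℕ) : ℕ := Nat.log 2 n + 1

/-- The bound `a · D · (log n)^a`; a quantity is `Õ(D)` when it is at most this for a constant `a`. -/
def softO (a n D : ℕ) : ℕ := a * D * lg n ^ a

/-- Probability of the event `E` under the uniform distribution on the finite nonempty type `Ω`. -/
def prob {Ω : Type} (E : Ω → Prop) : ℝ := (Nat.card {ω // E ω} : ℝ) / Nat.card Ω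

/-! ### The synchronous message-passing model -/

/-- A message is a string of bits. -/
abbrev Msg := List Bool

/-- The program of one vertex, its local input and random bits included. In every round it
sends at most one message to each address (vertices are addressed by their identifiers), and then
updates its state with the messages received, which are indexed by the identifiers of the senders.
Local computation is free. `Out` is the type of what the vertex outputs. -/
structure Machine (Out : Type) where
  State : Type
  start : State
  send : State → ℕ → Option Msg
  receive : State → (ℕ → Option Msg) → State
  output : State → Out

section Execution

variable {V : Type} (G : SimpleGraph V) (ident : V → ℕ) {Out : Type} (M : V → Machine Out)

/-- The message that crosses from `u` to `w`, when the states of the vertices are `σ`.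
Only neighbours can communicate. -/
def messageFrom (σ : (v : V) → (M v).State) (u w : V) : Option Msg :=
  if G.Adj u w then (M u).send (σ u) (ident w) else none

/-- The messages that reach `v`, indexed by the identifiers of their senders. -/
def inbox (σ : (v : V) → (M v).State) (v : V) : ℕ → Option Msg := fun i =>
  if h : ∃ u, ident u = i then messageFrom G ident M σ h.choose v else none

/-- The states of all vertices after `t` rounds. -/
def stateAt : ℕ → (v : V) → (M v).State
  | 0 => fun v => (M v).start
  | t + 1 => fun v => (M v).receive (stateAt t v) (inbox G ident M (stateAt t) v)

/-- The message sent from `u` to `w` in round `t` (rounds are numbered from `0`). -/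
def sent (t : ℕ) (u w : V) : Option Msg := messageFrom G ident M (stateAt G ident M t) u w

/-- The output of `v` after `t` rounds. -/
def outputAt (t : ℕ) (v : V) : Out := (M v).output (stateAt G ident M t v)

/-- In the first `r` rounds only messages of at most `B` bits are sent. -/
def MessagesAtMost (r B : ℕ) : Prop :=
  ∀ t < r, ∀ u w m, sent G ident M t u w = some m → m.length ≤ B

/-- The number of messages sent from `u` to `w` in the first `r` rounds. -/
def messageCount (r : ℕ) (u w : V) : ℕ :=
  ((Finset.range r).filter fun t => (sent G ident M t u w).isSome).card

/-- At most `c` messages are exchanged through each edge in the first `r` rounds. -/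
def CongestionAtMost (r c : ℕ) : Prop :=
  ∀ u w, G.Adj u w → messageCount G ident M r u w + messageCount G ident M r w u ≤ c

/-- In the first `r` rounds messages are sent only along the edges in `F`. -/
def SendsOnlyAlong (r : ℕ) (F : Set (Sym2 V)) : Prop :=
  ∀ t < r, ∀ u w, (sent G ident M t u w).isSome → s(u, w) ∈ F

end Execution

/-! ### Breadth-first search trees and heavy-light decompositions -/

variable {V : Type}

/-- A BFS tree of `G`: every vertex `v` other than the root has a neighbour as its parent that is
one step closer to the root. The parent of the root is the root itself, by convention. -/
structure BFSTree (G : SimpleGraph V) where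
  root : V
  parent : V → V
  parent_root : parent root = root
  adj_parent : ∀ v, v ≠ root → G.Adj v (parent v)
  dist_parent : ∀ v, v ≠ root → G.dist root (parent v) + 1 = G.dist root v

namespace BFSTree

variable {G : SimpleGraph V} (T : BFSTree G)

/-- `u` is an ancestor of `v` (possibly `u = v`), i.e. `u` lies on the tree path `π(s, v)` from
the root `s` to `v`. -/
def IsAncestor (u v : V) : Prop := ∃ i : ℕ, T.parent^[i] v = u

/-- `w` is a child of `u`. -/
def IsChild (w u : V) : Prop := w ≠ T.root ∧ T.parent w = u

/-- The vertex set of the subtree rooted at `x`. -/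
def subtree (x : V) : Set V := {v | T.IsAncestor x v}

/-- `V_x`, the proper descendants of `x`. -/
def below (x : V) : Set V := T.subtree x \ {x}

/-- The depth of the tree. -/
def depth [Fintype V] : ℕ := Finset.univ.sup fun v => G.dist T.root v

/-- `x` and `y` are independent: neither is an ancestor of the other. -/
def Independent (x y : V) : Prop := ¬ T.IsAncestor x y ∧ ¬ T.IsAncestor y x

/-- A choice of heavy children: the heavy child of a non-leaf vertex is a child whose subtree has
the largest number of vertices (ties are broken arbitrarily). -/
structure HeavyChoice where
  heavy : V → V
  isChild : ∀ u w, T.IsChild w u → T.IsChild (heavy u) u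
  largest : ∀ u w, T.IsChild w u → (T.subtree w).ncard ≤ (T.subtree (heavy u)).ncard

/-- `LD(x)`, the light descendants of `x`: the vertices in the subtrees of the light children. -/
def lightDescendants (H : T.HeavyChoice) (x : V) : Set V :=
  {v | ∃ w, T.IsChild w x ∧ w ≠ H.heavy x ∧ T.IsAncestor w v}

/-- `𝒞_x`, the connected components of `G[V_x]`. -/
abbrev Comp (x : V) := (G.induce (T.below x)).ConnectedComponent

/-- The edges `(u_C, v_C)` that define the connectivity trees: for every `x` other than the root
`s` and every component `C` of `G[V_x]` there is an edge `(u_C, v_C)` with `v_C ∈ C` and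
`x ∉ π(s, u_C)`; it determines the path `π_x(s, C) = π(s, u_C) ∘ (u_C, v_C)`. -/
structure ConnectingEdges where
  outer : (x : V) → T.Comp x → V
  inner : (x : V) → T.Comp x → V
  adj : ∀ x, x ≠ T.root → ∀ C, G.Adj (outer x C) (inner x C)
  inner_mem : ∀ x, x ≠ T.root → ∀ C,
    ∃ h : inner x C ∈ T.below x,
      (G.induce (T.below x)).connectedComponentMk ⟨inner x C, h⟩ = C
  avoids : ∀ x, x ≠ T.root → ∀ C, ¬ T.IsAncestor x (outer x C)

/-- The vertices of the path `π_x(s, C) = π(s, u_C) ∘ (u_C, v_C)`. -/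
def pathVertices (E : T.ConnectingEdges) (x : V) (C : T.Comp x) : Set V :=
  {y | T.IsAncestor y (E.outer x C) ∨ y = E.inner x C}

/-- `LDS(x, y) = {v ∈ LD(x) | y ∈ π_x(s, C_{x,v})}`, where `C_{x,v}` is the component of `v` in
`G[V_x]`: the light descendants of `x` in `y`-sensitive components. -/
def LDS (H : T.HeavyChoice) (E : T.ConnectingEdges) (x y : V) : Set V :=
  {v | v ∈ T.lightDescendants H x ∧ ∃ h : v ∈ T.below x,
    y ∈ T.pathVertices E x ((G.induce (T.below x)).connectedComponentMk ⟨v, h⟩)}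

/-- The edges that an algorithm for the pair `x, y` may use: those of the channel `Π_{x,y}`, and
those incident to `LDS(x, y) ∪ LDS(y, x)`. -/
def allowedEdges (H : T.HeavyChoice) (E : T.ConnectingEdges) {x y : V} (P : G.Path x y) :
    Set (Sym2 V) :=
  {e | e ∈ G.edgeSet ∧ (e ∈ (P : G.Walk x y).edges ∨ ∃ z ∈ T.LDS H E x y ∪ T.LDS H E y x, z ∈ e)}

end BFSTree

/-! ### The algorithms for single pairs -/

/-- A randomized algorithm with a Boolean output at every vertex. `Ω` is the (finite, uniform)
space of the random bits, shared or private, `node ω v` is the program of `v` once the random bits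
are drawn, and `rounds` is the number of rounds for which the algorithm runs. -/
structure Protocol (V Ω : Type) where
  rounds : ℕ
  node : Ω → V → Machine Bool

/-- The paths `P x y`, for `(x, y) ∈ Q`, satisfy the promise with constant `a`: their lengths are
`O(D)`, and every edge lies on `Õ(D)` of them. -/
def Promise [Fintype V] (G : SimpleGraph V) (a : ℕ) (Q : Finset (V × V))
    (P : (x y : V) → G.Path x y) : Prop :=
  (∀ p ∈ Q, (P p.1 p.2 : G.Walk p.1 p.2).length ≤ a * G.diam) ∧
  ∀ e ∈ G.edgeSet, (Q.filter fun p => e ∈ (P p.1 p.2 : G.Walk p.1 p.2).edges).card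
    ≤ softO a (Fintype.card V) G.diam

/-- `A` is an algorithm for the pair `x, y` with channel `P`, with constant `a`: for all outcomes
of its random bits it takes `Õ(D)` rounds with messages of `O(log n)` bits, exchanges `Õ(1)`
messages through each edge, and sends messages only along the edges of the channel and the edges
incident to `LDS(x, y) ∪ LDS(y, x)`. -/
structure IsPairAlgorithm [Fintype V] {Ω : Type} {G : SimpleGraph V} (ident : V → ℕ)
    (T : BFSTree G) (H : T.HeavyChoice) (E : T.ConnectingEdges) (a : ℕ) {x y : V}
    (P : G.Path x y) (A : Protocol V Ω) : Prop where
  rounds_le : A.rounds ≤ softO a (Fintype.card V) G.diam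
  bandwidth : ∀ ω, MessagesAtMost G ident (A.node ω) A.rounds (a * lg (Fintype.card V))
  congestion : ∀ ω, CongestionAtMost G ident (A.node ω) A.rounds (softO a (Fintype.card V) 1)
  allowed : ∀ ω, SendsOnlyAlong G ident (A.node ω) A.rounds (T.allowedEdges H E P)

/-- The output of `v` when `A` runs alone, with random bits `ω`. -/
def Protocol.soloOutput {Ω : Type} (A : Protocol V Ω) (G : SimpleGraph V) (ident : V → ℕ)
    (ω : Ω) (v : V) : Bool :=
  outputAt G ident (A.node ω) A.rounds v

/-- The answer for the pair `x, y`: whether `G ∖ {x, y}` is connected. -/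
def pairAnswer (G : SimpleGraph V) (x y : V) : Bool :=
  decide (G.induce ({x, y}ᶜ : Set V)).Connected

/-! ### Running many algorithms at once -/

/-- What a vertex knows of one of the algorithms that are to be run: for how many rounds it runs,
and the vertex's own program in it. -/
structure Job where
  rounds : ℕ
  machine : Machine Bool

/-- All that a vertex knows at the beginning of the simultaneous execution: the number of vertices,
the depth of the BFS tree, its own identifier and those of its neighbours, the identifier of its
parent (none for the root), and its jobs, indexed by the identifiers of `x` and `y`. -/
structure LocalView where
  n : ℕ
  depth : ℕ
  self : ℕ
  neighbors : Set ℕ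
  parent : Option ℕ
  jobs : ℕ → ℕ → Option Job

/-- A randomized distributed algorithm for running many algorithms at once. All vertices execute
the same program `node`, which sees nothing but the local view of the vertex and a private random
number drawn uniformly from `{0, …, range}`. The number of rounds is known to all vertices. A vertex
outputs a value for each of its jobs. -/
structure Scheduler where
  range : ℕ → ℕ → ℕ
  rounds : ℕ → ℕ → ℕ
  node : LocalView → ℕ → Machine (ℕ → ℕ → Option Bool)

/-- `v` is involved in the algorithm for a pair if it has an incident edge that this algorithm
may use. -/
def Involved (F : Set (Sym2 V)) (v : V) : Prop := ∃ e ∈ F, v ∈ e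

section Simultaneous

variable [Fintype V] {Ω : Type} {G : SimpleGraph V} (ident : V → ℕ) (T : BFSTree G)
  (H : T.HeavyChoice) (E : T.ConnectingEdges) (Q : Finset (V × V)) (P : (x y : V) → G.Path x y)
  (A : V × V → Protocol V Ω)

/-- The local view of `v`. Its jobs are its programs in those algorithms `A (x, y)`, for
`(x, y) ∈ Q`, in which it is involved, with their random bits drawn. -/
def localView (ω : Ω) (v : V) : LocalView where
  n := Fintype.card V
  depth := T.depth
  self := ident v
  neighbors := ident '' G.neighborSet v
  parent := if v = T.root then none else some (ident (T.parent v))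
  jobs := fun i j =>
    if h : ∃ p : V × V, p ∈ Q ∧ ident p.1 = i ∧ ident p.2 = j ∧
        Involved (T.allowedEdges H E (P p.1 p.2)) v
    then some ⟨(A h.choose).rounds, (A h.choose).node ω v⟩ else none

namespace Scheduler

variable (S : Scheduler)

/-- The private random numbers of the vertices. -/
abbrev Coins : Type := V → Fin (S.range (Fintype.card V) T.depth + 1)

/-- The number of rounds of the simultaneous execution. -/
def totalRounds : ℕ := S.rounds (Fintype.card V) T.depth

/-- The programs of the vertices in the simultaneous execution. -/
def machines (ω : Ω) (ρ : S.Coins T) (v : V) : Machine (ℕ → ℕ → Option Bool) :=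
  S.node (localView ident T H E Q P A ω v) (ρ v)

/-- What `v` outputs for the pair `p` at the end of the simultaneous execution. -/
def jointOutput (ω : Ω) (ρ : S.Coins T) (v : V) (p : V × V) : Option Bool :=
  outputAt G ident (S.machines ident T H E Q P A ω ρ) (S.totalRounds T) v
    (ident p.1) (ident p.2)

/-- The simultaneous execution succeeds: for all `(x, y) ∈ Q`, every vertex involved in
`A (x, y)` ends with the very output that it has when `A (x, y)` runs alone with the same random
bits. -/
def RunsAll (ω : Ω) (ρ : S.Coins T) : Prop :=
  ∀ p ∈ Q, ∀ v, Involved (T.allowedEdges H E (P p.1 p.2)) v →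
    S.jointOutput ident T H E Q P A ω ρ v p = some ((A p).soloOutput G ident ω v)

/-- For all `(x, y) ∈ Q`, both `x` and `y` end with the answer whether `G ∖ {x, y}` is
connected. -/
def AnswersAll (ω : Ω) (ρ : S.Coins T) : Prop :=
  ∀ p ∈ Q, ∀ z, (z = p.1 ∨ z = p.2) →
    S.jointOutput ident T H E Q P A ω ρ z p = some (pairAnswer G p.1 p.2)

end Scheduler

end Simultaneous

end CutPairs

end

noncomputable section

open scoped Classical

namespace CutPairs

/-! ### The load of an edge -/

namespace BFSTree

variable {V : Type} {G : SimpleGraph V} (T : BFSTree G)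

/-! The algorithms run with random delays. Time is cut into phases of Θ(log n) rounds, and the
algorithm of a pair p performs its round r in phase δ(p) + r, for a random δ(p) below some R = Õ(D).
If in every phase the messages due on each directed edge fit into the rounds of that phase, they are
sent one by one, tagged with the identifiers of their pair, and induction on the phases shows that
all simulated states are those of the solo runs (`Feasible.correctAt`).

Congestion is rare because only C = Õ(D) algorithms may use a given edge
(`card_filter_mem_allowedEdges_le`). The promise bounds the channels; and z lies in LDS(x, y) only
if x is one of the O(log n) light ancestors of z and y is one of the at most depth + 2 vertices of
π_x(s, C_{x,z}). An algorithm sends at most g = Õ(1) messages through an edge, so at most g delays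
make it active there in a fixed phase. For R ≥ 4gC, the probability that c of the algorithms are
active there together is at most 2^(-c) (`card_congested_seeds_le`), and c = Θ(log n) survives the
union bound over directed edges and phases.

This estimate uses the independence of only c delays at a time. So δ(p) can be the value, at a key
of p, of a random polynomial of degree below c over a prime field, reduced modulo R. The root draws
the c coefficients and broadcasts each of them down the tree in depth + 1 rounds; all vertices then
agree on the delays.

The bound holds for every outcome of the random bits of the single algorithms. The final claim
follows by averaging over these and a union bound over Q. -/

lemma isAncestor_refl (v : V) : T.IsAncestor v v := ⟨0, rfl⟩

lemma Independent.ne {T : BFSTree G} {x y : V} (h : T.Independent x y) : x ≠ y := by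
  rintro rfl; exact h.1 (T.isAncestor_refl x)

lemma IsAncestor.trans {T : BFSTree G} {u v w : V} (huv : T.IsAncestor u v)
    (hvw : T.IsAncestor v w) : T.IsAncestor u w := by
  obtain ⟨i, rfl⟩ := huv
  obtain ⟨j, rfl⟩ := hvw
  exact ⟨i + j, Function.iterate_add_apply _ _ _ _⟩

lemma isAncestor_parent (v : V) : T.IsAncestor (T.parent v) v := ⟨1, rfl⟩

/-- Truncated subtraction covers the root, which is its own parent by convention. -/
lemma dist_parent_eq (v : V) : G.dist T.root (T.parent v) = G.dist T.root v - 1 := by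
  by_cases h : v = T.root
  · subst h; simp [T.parent_root]
  · have := T.dist_parent v h; omega

lemma dist_iterate_parent (v : V) (i : ℕ) :
    G.dist T.root (T.parent^[i] v) = G.dist T.root v - i := by
  induction i with
  | zero => rfl
  | succ i ih => rw [Function.iterate_succ_apply', dist_parent_eq, ih]; omega

lemma eq_root_of_dist_eq_zero {v : V} (h : G.dist T.root v = 0) : v = T.root := by
  by_contra hv
  have := T.dist_parent v hv
  omega

lemma iterate_parent_dist (v : V) : T.parent^[G.dist T.root v] v = T.root :=
  T.eq_root_of_dist_eq_zero (by rw [dist_iterate_parent, Nat.sub_self])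

lemma iterate_parent_root (i : ℕ) : T.parent^[i] T.root = T.root :=
  Function.iterate_fixed T.parent_root i

lemma isAncestor_root {u : V} : T.IsAncestor u T.root ↔ u = T.root := by
  constructor
  · rintro ⟨i, rfl⟩; exact T.iterate_parent_root i
  · rintro rfl; exact T.isAncestor_refl _

/-- Iterates beyond the depth of `v` stay at the root. -/
lemma IsAncestor.eq_iterate {T : BFSTree G} {u v : V} (h : T.IsAncestor u v) :
    ∃ i ≤ G.dist T.root v, T.parent^[i] v = u := by
  obtain ⟨i, rfl⟩ := h
  rcases le_total i (G.dist T.root v) with hi | hi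
  · exact ⟨i, hi, rfl⟩
  · refine ⟨_, le_rfl, ?_⟩
    obtain ⟨j, rfl⟩ := Nat.exists_eq_add_of_le' hi
    rw [Function.iterate_add_apply, iterate_parent_dist, iterate_parent_root]

lemma IsAncestor.eq_of_dist_eq {T : BFSTree G} {u w v : V} (hu : T.IsAncestor u v)
    (hw : T.IsAncestor w v) (h : G.dist T.root u = G.dist T.root w) : u = w := by
  obtain ⟨i, hi, rfl⟩ := hu.eq_iterate
  obtain ⟨j, hj, rfl⟩ := hw.eq_iterate
  rw [dist_iterate_parent, dist_iterate_parent] at h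
  rw [show i = j by omega]

lemma IsAncestor.dist_le {T : BFSTree G} {u v : V} (h : T.IsAncestor u v) :
    G.dist T.root u ≤ G.dist T.root v := by
  obtain ⟨i, rfl⟩ := h
  rw [dist_iterate_parent]; omega

lemma IsAncestor.parent_of_ne {T : BFSTree G} {u v : V} (h : T.IsAncestor u v) (hne : u ≠ v) :
    T.IsAncestor u (T.parent v) := by
  obtain ⟨_ | i, rfl⟩ := h
  · exact absurd rfl hne
  · exact ⟨i, rfl⟩

lemma IsChild.dist_eq {T : BFSTree G} {w u : V} (h : T.IsChild w u) :
    G.dist T.root w = G.dist T.root u + 1 := by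
  rw [← h.2, T.dist_parent w h.1]

lemma IsChild.isAncestor {T : BFSTree G} {w u : V} (h : T.IsChild w u) : T.IsAncestor u w :=
  ⟨1, h.2⟩

lemma isChild_parent {v : V} (h : v ≠ T.root) : T.IsChild v (T.parent v) := ⟨h, rfl⟩

variable [Fintype V]

lemma dist_le_depth (v : V) : G.dist T.root v ≤ T.depth :=
  Finset.le_sup (f := fun v => G.dist T.root v) (Finset.mem_univ v)

lemma card_ancestors_le (v : V) :
    (Finset.univ.filter fun u => T.IsAncestor u v).card ≤ T.depth + 1 := by
  calc _ ≤ ((Finset.range (T.depth + 1)).image fun i => T.parent^[i] v).card := by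
        refine Finset.card_le_card fun u hu => ?_
        obtain ⟨i, hi, h⟩ := (Finset.mem_filter.1 hu).2.eq_iterate
        refine Finset.mem_image.2 ⟨i, Finset.mem_range.2 ?_, h⟩
        have := T.dist_le_depth v
        omega
    _ ≤ _ := by simpa using Finset.card_image_le (s := Finset.range (T.depth + 1))

/-! ### Light ancestors are logarithmic in number -/

variable (H : T.HeavyChoice)

/-- The vertices of which `v` is a light descendant. -/
def lightAncestors (v : V) : Finset V :=
  Finset.univ.filter fun x => v ∈ T.lightDescendants H x

lemma mem_lightAncestors {x v : V} :
    x ∈ T.lightAncestors H v ↔ v ∈ T.lightDescendants H x := by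
  simp [lightAncestors]

lemma lightAncestors_root : T.lightAncestors H T.root = ∅ := by
  refine Finset.eq_empty_of_forall_notMem fun x hx => ?_
  obtain ⟨w, hw, -, h⟩ := (T.mem_lightAncestors H).1 hx
  exact hw.1 (T.isAncestor_root.1 h)

lemma mem_lightAncestors_parent {x v : V} (hx : x ∈ T.lightAncestors H v) :
    x ∈ T.lightAncestors H (T.parent v) ∨ x = T.parent v ∧ v ≠ H.heavy x := by
  obtain ⟨w, hw, hne, h⟩ := (T.mem_lightAncestors H).1 hx
  by_cases hwv : w = v
  · subst hwv; exact Or.inr ⟨hw.2.symm, hne⟩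
  · exact Or.inl ((T.mem_lightAncestors H).2 ⟨w, hw, hne, h.parent_of_ne hwv⟩)

/-- The subtrees of `w` and of the heavy child are disjoint parts of the subtree of `u`, and the
heavy one is at least as large. -/
lemma ncard_subtree_light {w u : V} (hw : T.IsChild w u) (hne : w ≠ H.heavy u) :
    2 * (T.subtree w).ncard ≤ (T.subtree u).ncard := by
  have hh := H.isChild u w hw
  have hdisj : Disjoint (T.subtree w) (T.subtree (H.heavy u)) := by
    refine Set.disjoint_left.2 fun v h1 h2 => hne ?_
    exact IsAncestor.eq_of_dist_eq h1 h2 (by rw [hw.dist_eq, hh.dist_eq])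
  have hsub : T.subtree w ∪ T.subtree (H.heavy u) ⊆ T.subtree u := by
    rintro v (h | h)
    · exact hw.isAncestor.trans h
    · exact hh.isAncestor.trans h
  have h1 := Set.ncard_union_eq hdisj (Set.toFinite _) (Set.toFinite _)
  have h2 := Set.ncard_le_ncard hsub (Set.toFinite _)
  have h3 := H.largest u w hw
  omega

/-- Invariant of the walk down from the root: a step to a light child adds at most one light
ancestor and at least halves the subtree; a step to the heavy child adds none and does not enlarge
the subtree. -/
lemma two_pow_card_lightAncestors_mul_le (v : V) :
    2 ^ (T.lightAncestors H v).card * (T.subtree v).ncard ≤ Fintype.card V := by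
  induction hd : G.dist T.root v generalizing v with
  | zero =>
    rw [T.eq_root_of_dist_eq_zero hd, lightAncestors_root, Finset.card_empty, pow_zero, one_mul,
      ← Nat.card_eq_fintype_card]
    exact Set.ncard_le_card _
  | succ d ih =>
    have hv : v ≠ T.root := by rintro rfl; simp at hd
    have ih := ih (T.parent v) (by rw [dist_parent_eq, hd]; rfl)
    refine le_trans ?_ ih
    by_cases hl : v = H.heavy (T.parent v)
    · refine Nat.mul_le_mul (Nat.pow_le_pow_right (by norm_num) (Finset.card_le_card ?_))
        (Set.ncard_le_ncard ?_ (Set.toFinite _))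
      · intro x hx
        rcases T.mem_lightAncestors_parent H hx with h | ⟨rfl, h⟩
        · exact h
        · exact absurd hl h
      · exact fun u hu => (T.isAncestor_parent v).trans hu
    · have h1 : (T.lightAncestors H v).card ≤ (T.lightAncestors H (T.parent v)).card + 1 := by
        refine (Finset.card_le_card fun x hx => ?_).trans (Finset.card_insert_le (T.parent v) _)
        rcases T.mem_lightAncestors_parent H hx with h | ⟨rfl, h⟩
        · exact Finset.mem_insert_of_mem h
        · exact Finset.mem_insert_self _ _
      calc _ ≤ 2 ^ ((T.lightAncestors H (T.parent v)).card + 1) * (T.subtree v).ncard :=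
            Nat.mul_le_mul_right _ (Nat.pow_le_pow_right (by norm_num) h1)
        _ = 2 ^ (T.lightAncestors H (T.parent v)).card * (2 * (T.subtree v).ncard) := by ring
        _ ≤ _ := Nat.mul_le_mul_left _ (T.ncard_subtree_light H (T.isChild_parent hv) hl)

lemma card_lightAncestors_le (v : V) :
    (T.lightAncestors H v).card ≤ lg (Fintype.card V) := by
  have h := T.two_pow_card_lightAncestors_mul_le H v
  have h1 : 0 < (T.subtree v).ncard :=
    (Set.ncard_pos (Set.toFinite _)).2 ⟨v, T.isAncestor_refl v⟩
  have h2 : 2 ^ (T.lightAncestors H v).card ≤ Fintype.card V :=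
    (Nat.le_mul_of_pos_right _ h1).trans h
  exact (Nat.le_log_of_pow_le (by norm_num) h2).trans (Nat.le_succ _)

/-! ### Pairs whose algorithm may use a given edge -/

variable (E : T.ConnectingEdges)

lemma card_pathVertices_le (x : V) (C : T.Comp x) :
    (Finset.univ.filter fun y => y ∈ T.pathVertices E x C).card ≤ T.depth + 2 := by
  calc _ ≤ (insert (E.inner x C)
        (Finset.univ.filter fun u => T.IsAncestor u (E.outer x C))).card := by
        refine Finset.card_le_card fun y hy => ?_
        rcases (Finset.mem_filter.1 hy).2 with h | h
        · simp [h]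
        · simp [h]
    _ ≤ _ := (Finset.card_insert_le _ _).trans (Nat.succ_le_succ (T.card_ancestors_le _))

/-- The vertex `x` is a light ancestor of `z`; given `x`, the component of `z` fixes a single path
on which `y` must lie. -/
lemma card_filter_mem_LDS_le (z : V) :
    (Finset.univ.filter fun p : V × V => z ∈ T.LDS H E p.1 p.2).card
      ≤ lg (Fintype.card V) * (T.depth + 2) := by
  calc _ ≤ ((T.lightAncestors H z).biUnion fun x =>
        (Finset.univ.filter fun y => z ∈ T.LDS H E x y).image fun y => (x, y)).card := by
        refine Finset.card_le_card ?_
        rintro ⟨x, y⟩ h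
        have h := (Finset.mem_filter.1 h).2
        exact Finset.mem_biUnion.2 ⟨x, (T.mem_lightAncestors H).2 h.1,
          Finset.mem_image.2 ⟨y, by simpa using h, rfl⟩⟩
    _ ≤ (T.lightAncestors H z).card * (T.depth + 2) := by
        refine Finset.card_biUnion_le_card_mul _ _ _ fun x _ => Finset.card_image_le.trans ?_
        by_cases hz : z ∈ T.below x
        · refine (Finset.card_le_card fun y hy => ?_).trans
            (T.card_pathVertices_le E x ((G.induce (T.below x)).connectedComponentMk ⟨z, hz⟩))
          obtain ⟨-, _, h⟩ := (Finset.mem_filter.1 hy).2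
          exact Finset.mem_filter.2 ⟨Finset.mem_univ _, h⟩
        · rw [Finset.filter_false_of_mem]
          · simp
          · rintro y - ⟨-, h, -⟩; exact hz h
    _ ≤ _ := Nat.mul_le_mul_right _ (T.card_lightAncestors_le H z)

/-- The factor 4 counts the two endpoints of `e` and the two orders of `x` and `y` in `LDS`. -/
lemma card_filter_mem_allowedEdges_le {a : ℕ} {Q : Finset (V × V)}
    {P : (x y : V) → G.Path x y} (hP : Promise G a Q P) {e : Sym2 V} (he : e ∈ G.edgeSet) :
    (Q.filter fun p => e ∈ T.allowedEdges H E (P p.1 p.2)).card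
      ≤ softO a (Fintype.card V) G.diam + 4 * (lg (Fintype.card V) * (T.depth + 2)) := by
  induction e using Sym2.ind with | _ u w =>
  set L : V → Finset (V × V) := fun z => Finset.univ.filter fun p => z ∈ T.LDS H E p.1 p.2 with hL
  have hcard : ∀ z, (L z).card ≤ lg (Fintype.card V) * (T.depth + 2) :=
    T.card_filter_mem_LDS_le H E
  have hcard' : ∀ z, ((L z).image Prod.swap).card ≤ lg (Fintype.card V) * (T.depth + 2) :=
    fun z => Finset.card_image_le.trans (hcard z)
  have hsub : (Q.filter fun p => s(u, w) ∈ T.allowedEdges H E (P p.1 p.2)) ⊆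
      (Q.filter fun p => s(u, w) ∈ (P p.1 p.2 : G.Walk p.1 p.2).edges) ∪
        ((L u ∪ (L u).image Prod.swap) ∪ (L w ∪ (L w).image Prod.swap)) := by
    rintro ⟨x, y⟩ hp
    obtain ⟨hQ, -, h | ⟨z, hz, hze⟩⟩ := Finset.mem_filter.1 hp
    · exact Finset.mem_union_left _ (Finset.mem_filter.2 ⟨hQ, h⟩)
    · refine Finset.mem_union_right _ ?_
      have : (x, y) ∈ L z ∪ (L z).image Prod.swap := by
        rcases hz with hz | hz
        · exact Finset.mem_union_left _ (by simpa [hL] using hz)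
        · exact Finset.mem_union_right _
            (Finset.mem_image.2 ⟨(y, x), by simpa [hL] using hz, rfl⟩)
      rcases Sym2.mem_iff.1 hze with rfl | rfl
      · exact Finset.mem_union_left _ this
      · exact Finset.mem_union_right _ this
  have h0 := hP.2 _ he
  have h1 := Finset.card_le_card hsub
  have h2 := Finset.card_union_le (Q.filter fun p => s(u, w) ∈ (P p.1 p.2 : G.Walk p.1 p.2).edges)
    ((L u ∪ (L u).image Prod.swap) ∪ (L w ∪ (L w).image Prod.swap))
  have h3 := Finset.card_union_le (L u ∪ (L u).image Prod.swap) (L w ∪ (L w).image Prod.swap)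
  have h4 := Finset.card_union_le (L u) ((L u).image Prod.swap)
  have h5 := Finset.card_union_le (L w) ((L w).image Prod.swap)
  have := hcard u
  have := hcard w
  have := hcard' u
  have := hcard' w
  omega

/-- The vertices know the depth, while the bounds refer to the diameter; the two agree up to a
factor of two. -/
lemma depth_le_diam (hG : G.Connected) : T.depth ≤ G.diam :=
  Finset.sup_le fun _ _ =>
    SimpleGraph.dist_le_diam (have := hG.nonempty; SimpleGraph.connected_iff_ediam_ne_top.1 hG)

lemma diam_le_two_mul_depth (hG : G.Connected) : G.diam ≤ 2 * T.depth := by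
  have := hG.nonempty
  obtain ⟨u, v, h⟩ := G.exists_dist_eq_diam
  have h1 := hG.dist_triangle (u := u) (v := T.root) (w := v)
  have h2 := T.dist_le_depth u
  have h3 := T.dist_le_depth v
  rw [SimpleGraph.dist_comm] at h2
  omega

end BFSTree

/-! ### Random delays from polynomial hash functions -/

/-- The digit of `x` at position `l` in base `p`. -/
def digit (p x l : ℕ) : ℕ := x / p ^ l % p

/-- Thus a seed below `p ^ c` encodes a vector of `c` coefficients modulo `p`. -/
lemma eq_of_digit_eq {p : ℕ} {c x y : ℕ} (hx : x < p ^ c) (hy : y < p ^ c)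
    (h : ∀ l < c, digit p x l = digit p y l) : x = y := by
  induction c generalizing x y with
  | zero => simp at hx hy; omega
  | succ c ih =>
    have h0 := h 0 (Nat.succ_pos _)
    simp only [digit, pow_zero, Nat.div_one] at h0
    have h1 : x / p = y / p := by
      refine ih ?_ ?_ fun l hl => ?_
      · rw [pow_succ] at hx; exact Nat.div_lt_of_lt_mul (by rwa [mul_comm])
      · rw [pow_succ] at hy; exact Nat.div_lt_of_lt_mul (by rwa [mul_comm])
      · have := h (l + 1) (Nat.succ_lt_succ hl)
        simpa only [digit, pow_succ', ← Nat.div_div_eq_div_mul] using this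
    rw [← Nat.div_add_mod x p, ← Nat.div_add_mod y p, h0, h1]

/-- The value modulo `p` at `key` of the polynomial with coefficients `f 0, …, f (c - 1)`. -/
def polyHash (p c : ℕ) (f : ℕ → ℕ) (key : ℕ) : ℕ := (∑ l ∈ Finset.range c, f l * key ^ l) % p

/-- Polynomials of degree below `c` over a field coincide if they agree at `c` points; keys below
`p` stay distinct modulo `p`. -/
lemma eq_of_polyHash_eq {p : ℕ} (hp : p.Prime) {c : ℕ} {f g : ℕ → ℕ} (hf : ∀ l, f l < p)
    (hg : ∀ l, g l < p) {ι : Type} {S : Finset ι} (hS : S.card = c)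
    {key : ι → ℕ} (hkey : Set.InjOn key S) (hSp : ∀ i ∈ S, key i < p)
    (h : ∀ i ∈ S, polyHash p c f (key i) = polyHash p c g (key i)) : ∀ l < c, f l = g l := by
  have := Fact.mk hp
  let F : (ℕ → ℕ) → Polynomial (ZMod p) := fun f =>
    ∑ l ∈ Finset.range c, Polynomial.monomial l (f l : ZMod p)
  have hdeg : ∀ f, (F f).degree < (S.card : WithBot ℕ) := fun f => by
    rw [hS, ← Polynomial.mem_degreeLT]
    refine Submodule.sum_mem _ fun l hl => Polynomial.mem_degreeLT.2 ?_
    exact (Polynomial.degree_monomial_le _ _).trans_lt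
      (by exact_mod_cast Finset.mem_range.1 hl)
  have hcoeff : ∀ f, ∀ l < c, (F f).coeff l = (f l : ZMod p) := fun f l hl => by
    simp only [F, Polynomial.finsetSum_coeff, Polynomial.coeff_monomial]
    rw [Finset.sum_ite_eq' (Finset.range c) l]
    simp [hl]
  have heval : ∀ f, ∀ key : ℕ, (F f).eval (key : ZMod p) = (polyHash p c f key : ZMod p) :=
    fun f key => by simp [F, polyHash, Polynomial.eval_finsetSum, Polynomial.eval_monomial]
  have hinj : Set.InjOn (fun i => (key i : ZMod p)) S := fun x hx y hy hxy => hkey hx hy (by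
    have := (ZMod.natCast_eq_natCast_iff' _ _ _).1 hxy
    rwa [Nat.mod_eq_of_lt (hSp x hx), Nat.mod_eq_of_lt (hSp y hy)] at this)
  have hFG : F f = F g := Polynomial.eq_of_degrees_lt_of_eval_index_eq S hinj (hdeg f) (hdeg g)
    fun i hi => by rw [heval, heval, h i hi]
  intro l hl
  have := congrArg (fun q => Polynomial.coeff q l) hFG
  simp only [hcoeff _ l hl] at this
  have := (ZMod.natCast_eq_natCast_iff' _ _ _).1 this
  rwa [Nat.mod_eq_of_lt (hf l), Nat.mod_eq_of_lt (hg l)] at this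

/-- The delay with the key `key`, below `R`, determined by the seed `x`. -/
def seedDelay (p c R x key : ℕ) : ℕ := polyHash p c (digit p x) key % R

/-- Each residue class modulo `R` has at most `p / R + 1` members below `p`. -/
lemma card_filter_mod_mem_le (p : ℕ) {R : ℕ} (B : Finset ℕ) :
    ((Finset.range p).filter fun y => y % R ∈ B).card ≤ B.card * (p / R + 1) := by
  calc _ ≤ (B ×ˢ Finset.range (p / R + 1)).card := by
        refine Finset.card_le_card_of_injOn (fun y => (y % R, y / R)) (fun y hy => ?_)
          fun x _ y _ hxy => ?_
        · obtain ⟨h1, h2⟩ := Finset.mem_filter.1 hy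
          exact Finset.mem_product.2 ⟨h2, Finset.mem_range.2 (Nat.lt_succ_of_le
            (Nat.div_le_div_right (Finset.mem_range.1 h1).le))⟩
        · obtain ⟨h1, h2⟩ := Prod.ext_iff.1 hxy
          rw [← Nat.div_add_mod x R, ← Nat.div_add_mod y R]
          simp only at h1 h2
          rw [h1, h2]
    _ = _ := by simp

/-- The delays of `c` distinct keys are independent. -/
lemma card_seeds_le {p : ℕ} (hp : p.Prime) {c R g : ℕ} {ι : Type} {S : Finset ι}
    (hS : S.card = c) {key : ι → ℕ} (hkey : Set.InjOn key S) (hSp : ∀ i ∈ S, key i < p)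
    (B : ι → Finset ℕ) (hB : ∀ i ∈ S, (B i).card ≤ g) :
    ((Finset.range (p ^ c)).filter fun x => ∀ i ∈ S, seedDelay p c R x (key i) ∈ B i).card
      ≤ (g * (p / R + 1)) ^ c := by
  have hd : ∀ x l, digit p x l < p := fun x l => Nat.mod_lt _ hp.pos
  calc _ ≤ (S.pi fun i => (Finset.range p).filter fun y => y % R ∈ B i).card := by
        -- By interpolation, the hash values at the `c` keys determine the seed.
        refine Finset.card_le_card_of_injOn (fun x i _ => polyHash p c (digit p x) (key i))
          (fun x hx => ?_) fun x hx y hy hxy => ?_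
        · refine Finset.mem_pi.2 fun i hi => Finset.mem_filter.2 ⟨?_, ?_⟩
          · exact Finset.mem_range.2 (Nat.mod_lt _ hp.pos)
          · exact (Finset.mem_filter.1 hx).2 i hi
        · refine eq_of_digit_eq (Finset.mem_range.1 (Finset.mem_filter.1 hx).1)
            (Finset.mem_range.1 (Finset.mem_filter.1 hy).1) ?_
          refine eq_of_polyHash_eq hp (hd x) (hd y) hS hkey hSp fun i hi => ?_
          exact congrFun (congrFun hxy i) hi
    _ ≤ _ := by
        rw [Finset.card_pi, ← hS]
        refine Finset.prod_le_pow_card _ _ _ fun i hi => ?_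
        exact (card_filter_mod_mem_le p _).trans (Nat.mul_le_mul_right _ (hB i hi))

/-- With at most `C` keys, it is unlikely that `c` of them have a delay among `g` bad ones. -/
lemma card_congested_seeds_le {p : ℕ} (hp : p.Prime) {c R g C : ℕ} (hRp : R ≤ p)
    (hgC : 4 * (g * C) ≤ R) {ι : Type} {K : Finset ι} (hK : K.card ≤ C) {key : ι → ℕ}
    (hkey : Set.InjOn key K) (hKp : ∀ i ∈ K, key i < p)
    (B : ι → Finset ℕ) (hB : ∀ i ∈ K, (B i).card ≤ g) :
    2 ^ c * ((Finset.range (p ^ c)).filter fun x =>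
      c ≤ (K.filter fun i => seedDelay p c R x (key i) ∈ B i).card).card ≤ p ^ c := by
  have h1 : ((Finset.range (p ^ c)).filter fun x =>
      c ≤ (K.filter fun i => seedDelay p c R x (key i) ∈ B i).card).card ≤
      C ^ c * (g * (p / R + 1)) ^ c := by
    -- If at least `c` keys have a bad delay, then all keys of some `c`-element subset have one.
    calc _ ≤ ((K.powersetCard c).biUnion fun S => (Finset.range (p ^ c)).filter fun x =>
          ∀ i ∈ S, seedDelay p c R x (key i) ∈ B i).card := by
          refine Finset.card_le_card fun x hx => ?_
          obtain ⟨hx1, hx2⟩ := Finset.mem_filter.1 hx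
          obtain ⟨S, hS, hSc⟩ := Finset.exists_subset_card_eq hx2
          refine Finset.mem_biUnion.2 ⟨S, Finset.mem_powersetCard.2
            ⟨hS.trans (Finset.filter_subset _ _), hSc⟩, Finset.mem_filter.2 ⟨hx1, ?_⟩⟩
          exact fun i hi => (Finset.mem_filter.1 (hS hi)).2
      _ ≤ (K.powersetCard c).card * (g * (p / R + 1)) ^ c := by
          refine Finset.card_biUnion_le_card_mul _ _ _ fun S hS => ?_
          obtain ⟨hSK, hSc⟩ := Finset.mem_powersetCard.1 hS
          exact card_seeds_le hp hSc (hkey.mono (Finset.coe_subset.2 hSK))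
            (fun i h => hKp i (hSK h)) B fun i h => hB i (hSK h)
      _ ≤ _ := by
          rw [Finset.card_powersetCard]
          exact Nat.mul_le_mul_right _ ((Nat.choose_le_pow _ _).trans (Nat.pow_le_pow_left hK _))
  refine (Nat.mul_le_mul_left _ h1).trans ?_
  rw [← mul_pow, ← mul_pow]
  refine Nat.pow_le_pow_left ?_ _
  -- Rounding costs a factor 2 since `R ≤ p`; the 4 in `hgC` pays for it and for the base of `2 ^
  -- c`.
  have h2 : R * (p / R + 1) ≤ 2 * p := by
    have := Nat.mul_div_le p R
    rw [mul_add, mul_one]; omega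
  have h3 : 4 * (g * C) * (p / R + 1) ≤ 2 * p := (Nat.mul_le_mul_right _ hgC).trans h2
  nlinarith

/-! ### Encoding and time slots -/

lemma bits_injective : Function.Injective Nat.bits := fun x y h =>
  Nat.eq_of_testBit_eq fun i => by rw [Nat.testBit_eq_inth, Nat.testBit_eq_inth, h]

/-- The number with the given binary digits. -/
def ofBits : List Bool → ℕ := Function.invFun Nat.bits

lemma ofBits_bits (x : ℕ) : ofBits x.bits = x := Function.leftInverse_invFun bits_injective x

/-- A self-delimiting encoding of bit strings. -/
def delimit : List Bool → List Bool
  | [] => [false]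
  | b :: l => true :: b :: delimit l

lemma length_delimit (l : List Bool) : (delimit l).length = 2 * l.length + 1 := by
  induction l with
  | nil => rfl
  | cons b l ih => simp only [delimit, List.length_cons, ih]; ring

/-- The code is prefix-free: `true` announces each further bit, `false` marks the end. -/
lemma delimit_append_inj {l l' r r' : List Bool} (h : delimit l ++ r = delimit l' ++ r') :
    l = l' ∧ r = r' := by
  induction l generalizing l' with
  | nil => cases l' <;> simp_all [delimit]
  | cons b l ih =>
    cases l' with
    | nil => simp [delimit] at h
    | cons b' l' =>
      simp only [delimit, List.cons_append, List.cons.injEq, true_and] at h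
      obtain ⟨h1, h2⟩ := ih h.2
      exact ⟨by rw [h.1, h1], h2⟩

/-- The message `m` tagged with a pair of numbers. -/
def pack (i : ℕ × ℕ) (m : Msg) : Msg := delimit i.1.bits ++ (delimit i.2.bits ++ m)

lemma length_pack (i : ℕ × ℕ) (m : Msg) :
    (pack i m).length = 2 * i.1.size + 2 * i.2.size + m.length + 2 := by
  simp only [pack, List.length_append, length_delimit, Nat.size_eq_bits_len]
  ring

lemma pack_inj {i i' : ℕ × ℕ} {m m' : Msg} (h : pack i m = pack i' m') : i = i' ∧ m = m' := by
  obtain ⟨h1, h2⟩ := delimit_append_inj h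
  obtain ⟨h2, h3⟩ := delimit_append_inj h2
  exact ⟨Prod.ext (bits_injective h1) (bits_injective h2), h3⟩

/-- The number of indices before `i` for which `f` has a message. -/
def slotOf (f : ℕ × ℕ → Option Msg) (i : ℕ × ℕ) : ℕ :=
  Nat.count (fun c => (f (Nat.unpair c)).isSome) (Nat.pair i.1 i.2)

/-- The message sent in slot `s`, when the messages `f` are sent one by one. -/
def slotMsg (f : ℕ × ℕ → Option Msg) (s : ℕ) : Option Msg :=
  if h : ∃ i, (f i).isSome ∧ slotOf f i = s then (f h.choose).map (pack h.choose) else none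

/-- The message with tag `i` among the messages received in `c` slots. -/
def collect (c : ℕ) (g : ℕ → Option Msg) (i : ℕ × ℕ) : Option Msg :=
  if h : ∃ m, ∃ s < c, g s = some (pack i m) then some h.choose else none

/-- A message is withheld if it has more than `b` bits. -/
def bounded (b : ℕ) (o : Option Msg) : Option Msg := o.filter fun m => m.length ≤ b

lemma bounded_eq_some {b : ℕ} {o : Option Msg} {m : Msg} :
    bounded b o = some m ↔ o = some m ∧ m.length ≤ b := by
  simp [bounded, Option.filter_eq_some_iff]

lemma slotOf_injOn {f : ℕ × ℕ → Option Msg} {i j : ℕ × ℕ} (hi : (f i).isSome)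
    (hj : (f j).isSome) (h : slotOf f i = slotOf f j) : i = j := by
  have := Nat.count_injective (p := fun c => ((f (Nat.unpair c)).isSome : Prop))
    (by simpa using hi) (by simpa using hj) h
  simpa [Prod.ext_iff] using this

/-- The slot is the rank of `i` among the indices that have a message. -/
lemma slotOf_lt {f : ℕ × ℕ → Option Msg} {i : ℕ × ℕ} (hi : (f i).isSome) {F : Finset (ℕ × ℕ)}
    (hF : ∀ j, (f j).isSome → j ∈ F) : slotOf f i < F.card := by
  have hsub : {c | (f (Nat.unpair c)).isSome} ⊆
      ((F.image fun j => Nat.pair j.1 j.2 : Finset ℕ) : Set ℕ) := fun c hc =>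
    Finset.mem_coe.2 (Finset.mem_image.2 ⟨Nat.unpair c, hF _ hc, Nat.pair_unpair c⟩)
  have hfin : (Set.ofPred fun c => ((f (Nat.unpair c)).isSome : Prop)).Finite :=
    (Finset.finite_toSet _).subset hsub
  refine (Nat.count_lt_card hfin (by simpa using hi)).trans_le ?_
  refine (Finset.card_le_card fun c hc => ?_).trans
    (Finset.card_image_le (f := fun j : ℕ × ℕ => Nat.pair j.1 j.2))
  exact Finset.mem_coe.1 (hsub (hfin.mem_toFinset.1 hc))

lemma slotMsg_eq_some {f : ℕ × ℕ → Option Msg} {s : ℕ} {m : Msg} :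
    slotMsg f s = some m ↔ ∃ i m', f i = some m' ∧ slotOf f i = s ∧ m = pack i m' := by
  constructor
  · intro h
    unfold slotMsg at h
    split_ifs at h with hex
    obtain ⟨m', hm', hm⟩ := Option.map_eq_some_iff.1 h
    exact ⟨_, m', hm', hex.choose_spec.2, hm.symm⟩
  · rintro ⟨i, m', hi, hs, rfl⟩
    have hex : ∃ i, (f i).isSome ∧ slotOf f i = s := ⟨i, by simp [hi], hs⟩
    have : hex.choose = i := slotOf_injOn hex.choose_spec.1 (by simp [hi])
      (hex.choose_spec.2.trans hs.symm)
    rw [slotMsg, dif_pos hex, this, hi, Option.map_some]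

/-- Slots do not collide and tags can be decoded, so the receiver recovers `f` exactly, if there are
enough slots and no message is withheld. -/
lemma collect_slotMsg {f : ℕ × ℕ → Option Msg} {b : ℕ} {F : Finset (ℕ × ℕ)}
    (hF : ∀ j, (f j).isSome → j ∈ F) {c : ℕ} (hc : F.card ≤ c)
    (hb : ∀ j m, f j = some m → (pack j m).length ≤ b) (i : ℕ × ℕ) :
    collect c (fun s => bounded b (slotMsg f s)) i = f i := by
  have key : ∀ m, (∃ s < c, bounded b (slotMsg f s) = some (pack i m)) ↔ f i = some m := by
    intro m
    constructor
    · rintro ⟨s, -, h⟩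
      obtain ⟨j, m', hj, -, h⟩ := slotMsg_eq_some.1 (bounded_eq_some.1 h).1
      obtain ⟨rfl, rfl⟩ := pack_inj h
      exact hj
    · intro h
      exact ⟨slotOf f i, (slotOf_lt (by simp [h]) hF).trans_le hc,
        bounded_eq_some.2 ⟨slotMsg_eq_some.2 ⟨i, m, h, rfl, rfl⟩, hb i m h⟩⟩
  unfold collect
  split_ifs with h
  · exact ((key _).1 h.choose_spec).symm
  · cases hi : f i with
    | none => rfl
    | some m => exact absurd ⟨m, (key m).2 hi⟩ h

lemma collect_none (c : ℕ) (i : ℕ × ℕ) : collect c (fun _ => none) i = none := by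
  simp [collect]

/-! ### Machines that remember everything -/

/-- What a vertex has heard: the message of each round and sender. -/
abbrev History := ℕ → ℕ → Option Msg

/-- A machine whose messages and output are functions of the time and of what it has heard. -/
def historyMachine {Out : Type} (emit : ℕ → History → ℕ → Option Msg) (out : History → Out) :
    Machine Out where
  State := ℕ × History
  start := (0, fun _ _ => none)
  send σ q := emit σ.1 σ.2 q
  receive σ i := (σ.1 + 1, Function.update σ.2 σ.1 i)
  output σ := out σ.2

section Execution

variable {V : Type} (G : SimpleGraph V) (ident : V → ℕ) {Out : Type}

lemma inbox_ident (hid : Function.Injective ident) (M : V → Machine Out)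
    (σ : (v : V) → (M v).State) (u v : V) :
    inbox G ident M σ v (ident u) = messageFrom G ident M σ u v := by
  have h : ∃ w, ident w = ident u := ⟨u, rfl⟩
  rw [inbox, dif_pos h, hid h.choose_spec]

lemma inbox_of_notMem (M : V → Machine Out) (σ : (v : V) → (M v).State) (v : V) {q : ℕ}
    (hq : ∀ u, ident u ≠ q) : inbox G ident M σ v q = none :=
  dif_neg fun ⟨u, hu⟩ => hq u hu

/-- The complete history of `v`. -/
def heard (M : V → Machine Out) (v : V) : History :=
  fun t => inbox G ident M (stateAt G ident M t) v

variable (emit : V → ℕ → History → ℕ → Option Msg) (out : V → History → Out)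

lemma stateAt_historyMachine (t : ℕ) (v : V) :
    stateAt G ident (fun v => historyMachine (emit v) (out v)) t v =
      (t, fun τ => if τ < t then heard G ident (fun v => historyMachine (emit v) (out v)) v τ
        else fun _ => none) := by
  induction t with
  | zero => rfl
  | succ t ih =>
    have h : stateAt G ident (fun v => historyMachine (emit v) (out v)) (t + 1) v =
      ((stateAt G ident (fun v => historyMachine (emit v) (out v)) t v).1 + 1,
        Function.update (stateAt G ident (fun v => historyMachine (emit v) (out v)) t v).2
          (stateAt G ident (fun v => historyMachine (emit v) (out v)) t v).1
          (heard G ident (fun v => historyMachine (emit v) (out v)) v t)) := rfl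
    rw [h, ih]
    refine Prod.ext rfl (funext fun τ => ?_)
    simp only [Function.update_apply]
    rcases lt_trichotomy τ t with h | rfl | h
    · rw [if_neg h.ne, if_pos h, if_pos (h.trans (Nat.lt_succ_self _))]
    · rw [if_pos rfl, if_pos (Nat.lt_succ_self _)]
    · rw [if_neg h.ne', if_neg (by omega), if_neg (by omega)]

/-- By causality, `hemit`, the complete history can stand in for the recorded part of it, which
gives a recursion for messages without mention of states. -/
lemma heard_historyMachine (hid : Function.Injective ident)
    (hemit : ∀ v t h h' q, (∀ τ < t, h τ = h' τ) → emit v t h q = emit v t h' q)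
    (t : ℕ) (u v : V) :
    heard G ident (fun v => historyMachine (emit v) (out v)) v t (ident u) =
      if G.Adj u v then
        emit u t (heard G ident (fun v => historyMachine (emit v) (out v)) u) (ident v)
      else none := by
  rw [heard, inbox_ident G ident hid, messageFrom]
  split_ifs
  · change emit u (stateAt G ident (fun v => historyMachine (emit v) (out v)) t u).1
      (stateAt G ident (fun v => historyMachine (emit v) (out v)) t u).2 (ident v) = _
    rw [stateAt_historyMachine]
    exact hemit _ _ _ _ _ fun τ hτ => if_pos hτ
  · rfl

end Execution

/-! ### The simultaneous execution -/

/-- The parameters of the simultaneous execution. -/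
structure Plan where
  /-- the number of rounds in each phase, and of coefficients of the hash function -/
  slots : ℕ
  /-- the number of rounds for the broadcast of a coefficient -/
  hop : ℕ
  /-- the modulus of the hash function -/
  modulus : ℕ
  /-- an upper bound of the identifiers -/
  base : ℕ
  /-- all delays are smaller than this number of phases -/
  delays : ℕ
  /-- the number of phases -/
  phases : ℕ
  /-- the maximal length of a message -/
  width : ℕ

namespace Plan

variable (P : Plan)

/-- The number of rounds for the broadcast of the seed. -/
def seedTime : ℕ := P.slots * P.hop

/-- The number of rounds of the whole execution. -/
def endTime : ℕ := P.seedTime + P.phases * P.slots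

/-- The key of a pair of identifiers. -/
def key (i : ℕ × ℕ) : ℕ := i.1 * P.base + i.2

/-- The coefficients of the hash function, as the root draws them, or as other vertices receive
them from their parents. -/
def learned (W : LocalView) (x : ℕ) (h : History) (l : ℕ) : ℕ :=
  match W.parent with
  | none => digit P.modulus x l
  | some q => ofBits ((h ((l + 1) * P.hop - 1) q).getD [])

/-- The number of the phase in which the algorithm with index `i` starts. -/
def delay (W : LocalView) (x : ℕ) (h : History) (i : ℕ × ℕ) : ℕ :=
  polyHash P.modulus P.slots (P.learned W x h) (P.key i) % P.delays

/-- The simulated state, after `r` rounds, in the algorithm with index `i` and delay `δ`. -/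
def simState (J : Job) (δ : ℕ) (i : ℕ × ℕ) (h : History) : ℕ → J.machine.State
  | 0 => J.machine.start
  | r + 1 => J.machine.receive (simState J δ i h r) fun q =>
      collect P.slots (fun s => h (P.seedTime + (δ + r) * P.slots + s) q) i

/-- The message for `q` in phase `k` in the algorithm with index `i`. -/
def outgoing (W : LocalView) (x : ℕ) (h : History) (k q : ℕ) (i : ℕ × ℕ) : Option Msg :=
  (W.jobs i.1 i.2).bind fun J =>
    if P.delay W x h i ≤ k ∧ k < P.delay W x h i + J.rounds then
      J.machine.send (P.simState J (P.delay W x h i) i h (k - P.delay W x h i)) q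
    else none

/-- What is forwarded during the broadcast of the seed. -/
def forward (W : LocalView) (x : ℕ) (t : ℕ) (h : History) : Option Msg :=
  match W.parent with
  | none => some (digit P.modulus x (t / P.hop)).bits
  | some q => if t = 0 then none else h (t - 1) q

/-- The message for `q` in round `t`. -/
def emit (W : LocalView) (x : ℕ) (t : ℕ) (h : History) (q : ℕ) : Option Msg :=
  bounded P.width
    (if t < P.seedTime then P.forward W x t h
    else slotMsg (P.outgoing W x h ((t - P.seedTime) / P.slots) q) ((t - P.seedTime) % P.slots))

/-- The simulated outputs. -/
def result (W : LocalView) (x : ℕ) (h : History) (i j : ℕ) : Option Bool :=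
  (W.jobs i j).map fun J =>
    J.machine.output (P.simState J (P.delay W x h (i, j)) (i, j) h J.rounds)

/-- The program of a vertex. -/
def machine (W : LocalView) (x : ℕ) : Machine (ℕ → ℕ → Option Bool) :=
  historyMachine (P.emit W x) (P.result W x)

/-! ### Causality: messages and outputs depend only on the past -/

variable {P} {W : LocalView} {x : ℕ} {h h' : History}

lemma delay_congr (hhop : 0 < P.hop) (hh : ∀ τ < P.seedTime, h τ = h' τ) (i : ℕ × ℕ) :
    P.delay W x h i = P.delay W x h' i := by
  have : ∀ l ∈ Finset.range P.slots, P.learned W x h l = P.learned W x h' l := by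
    intro l hl
    unfold learned
    cases W.parent with
    | none => rfl
    | some q =>
      have h1 : (l + 1) * P.hop ≤ P.slots * P.hop :=
        Nat.mul_le_mul_right _ (Finset.mem_range.1 hl)
      have h2 : 0 < (l + 1) * P.hop := Nat.mul_pos (Nat.succ_pos _) hhop
      simp only
      rw [hh _ (by unfold seedTime; omega)]
  simp only [delay, polyHash]
  rw [Finset.sum_congr rfl fun l hl => by rw [this l hl]]

lemma collect_congr {c : ℕ} {g g' : ℕ → Option Msg} (hg : ∀ s < c, g s = g' s) (i : ℕ × ℕ) :
    collect c g i = collect c g' i := by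
  have : ∀ m, (∃ s < c, g s = some (pack i m)) = ∃ s < c, g' s = some (pack i m) := fun m =>
    propext ⟨fun ⟨s, hs, h⟩ => ⟨s, hs, hg s hs ▸ h⟩, fun ⟨s, hs, h⟩ => ⟨s, hs, hg s hs ▸ h⟩⟩
  simp only [collect, this]

lemma simState_congr (J : Job) (δ : ℕ) (i : ℕ × ℕ) (r : ℕ)
    (hh : ∀ τ < P.seedTime + (δ + r) * P.slots, h τ = h' τ) :
    P.simState J δ i h r = P.simState J δ i h' r := by
  induction r with
  | zero => rfl
  | succ r ih =>
    have h1 : (δ + (r + 1)) * P.slots = (δ + r) * P.slots + P.slots := by ring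
    rw [h1] at hh
    simp only [simState]
    rw [ih fun τ hτ => hh τ (by omega)]
    congr 1
    funext q
    exact collect_congr (fun s hs => by rw [hh _ (by omega)]) i

lemma emit_congr (hhop : 0 < P.hop) (t q : ℕ) (hh : ∀ τ < t, h τ = h' τ) :
    P.emit W x t h q = P.emit W x t h' q := by
  unfold emit
  split_ifs with ht
  · unfold forward
    cases W.parent with
    | none => rfl
    | some q' =>
      simp only
      split_ifs with h0
      · rfl
      · rw [hh _ (by omega)]
  · have hd : ∀ i, P.delay W x h i = P.delay W x h' i :=
      delay_congr hhop fun τ hτ => hh τ (by omega)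
    have : ∀ i, P.outgoing W x h ((t - P.seedTime) / P.slots) q i =
        P.outgoing W x h' ((t - P.seedTime) / P.slots) q i := fun i => by
      unfold outgoing
      cases W.jobs i.1 i.2 with
      | none => rfl
      | some J =>
        simp only [Option.bind_some, hd i]
        split_ifs with hk
        -- The state that determines a message of phase `k` is computed from the phases before `k`.
        · rw [simState_congr J _ i _ fun τ hτ => hh τ ?_]
          rw [Nat.add_sub_cancel' hk.1] at hτ
          have := Nat.div_mul_le_self (t - P.seedTime) P.slots
          omega
        · rfl
    rw [funext this]

lemma result_congr (hhop : 0 < P.hop) (i j : ℕ) (hh0 : ∀ τ < P.seedTime, h τ = h' τ)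
    (hh : ∀ J, W.jobs i j = some J →
      ∀ τ < P.seedTime + (P.delay W x h' (i, j) + J.rounds) * P.slots, h τ = h' τ) :
    P.result W x h i j = P.result W x h' i j := by
  unfold result
  cases hJ : W.jobs i j with
  | none => rfl
  | some J => rw [Option.map_some, Option.map_some, delay_congr hhop hh0,
      simState_congr J _ _ _ (hh J hJ)]

end Plan

section Correctness

variable {V : Type} [Fintype V] {Ω : Type} {G : SimpleGraph V} (ident : V → ℕ) (T : BFSTree G)
  (H : T.HeavyChoice) (E : T.ConnectingEdges) (Q : Finset (V × V)) (P : (x y : V) → G.Path x y)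
  (A : V × V → Protocol V Ω) (L : Plan) (ω : Ω) (ρ : V → ℕ)

variable {ident Q P A} in
lemma localView_jobs (hid : Function.Injective ident) {p : V × V} (hp : p ∈ Q) {v : V}
    (hv : Involved (T.allowedEdges H E (P p.1 p.2)) v) :
    (localView ident T H E Q P A ω v).jobs (ident p.1) (ident p.2) =
      some ⟨(A p).rounds, (A p).node ω v⟩ := by
  have h : ∃ q : V × V, q ∈ Q ∧ ident q.1 = ident p.1 ∧ ident q.2 = ident p.2 ∧
      Involved (T.allowedEdges H E (P q.1 q.2)) v := ⟨p, hp, rfl, rfl, hv⟩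
  have hq : h.choose = p :=
    Prod.ext (hid h.choose_spec.2.1) (hid h.choose_spec.2.2.1)
  simp only [localView]
  rw [dif_pos h, hq]

lemma exists_of_localView_jobs {v : V} {i : ℕ × ℕ} {J : Job}
    (hJ : (localView ident T H E Q P A ω v).jobs i.1 i.2 = some J) :
    ∃ p ∈ Q, (ident p.1, ident p.2) = i ∧ Involved (T.allowedEdges H E (P p.1 p.2)) v ∧
      J = ⟨(A p).rounds, (A p).node ω v⟩ := by
  simp only [localView] at hJ
  split_ifs at hJ with h
  obtain ⟨h1, h2, h3, h4⟩ := h.choose_spec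
  exact ⟨h.choose, h1, Prod.ext h2 h3, h4, (Option.some.inj hJ).symm⟩

/-- The programs of all vertices in the execution with the parameters `L`. -/
def planMachines (v : V) : Machine (ℕ → ℕ → Option Bool) :=
  L.machine (localView ident T H E Q P A ω v) (ρ v)

/-- The delay of the algorithm for the pair `p`. -/
def pairDelay (x : ℕ) (p : V × V) : ℕ :=
  seedDelay L.modulus L.slots L.delays x (L.key (ident p.1, ident p.2))

/-- With seed `x`, the algorithm for the pair `p` sends a message from `u` to `v` in phase `k`. -/
def ActiveAt (x : ℕ) (p : V × V) (k : ℕ) (u v : V) : Prop :=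
  pairDelay ident L x p ≤ k ∧ k < pairDelay ident L x p + (A p).rounds ∧
    (sent G ident ((A p).node ω) (k - pairDelay ident L x p) u v).isSome

/-- The conditions under which the simultaneous execution succeeds. -/
structure Feasible : Prop where
  injective : Function.Injective ident
  hop_eq : L.hop = T.depth + 1
  seed_width : ∀ l, (digit L.modulus (ρ T.root) l).bits.length ≤ L.width
  job_width : ∀ p ∈ Q, ∀ t < (A p).rounds, ∀ u v m, sent G ident ((A p).node ω) t u v = some m →
    (pack (ident p.1, ident p.2) m).length ≤ L.width
  allowed : ∀ p ∈ Q, SendsOnlyAlong G ident ((A p).node ω) (A p).rounds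
    (T.allowedEdges H E (P p.1 p.2))
  delay_add_rounds_le : ∀ p ∈ Q, pairDelay ident L (ρ T.root) p + (A p).rounds ≤ L.phases
  uncongested : ∀ u v, G.Adj u v → ∀ k < L.phases,
    (Q.filter fun p => ActiveAt (G := G) ident A L ω (ρ T.root) p k u v).card ≤ L.slots

local notation "W" => localView ident T H E Q P A ω
local notation "hrd" => heard G ident (planMachines ident T H E Q P A L ω ρ)
local notation "dly" => pairDelay ident L (ρ T.root)

variable {ident T H E Q P A L ω ρ}

/-! ### Correctness of the simulation in the absence of congestion -/

namespace Feasible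

lemma hop_pos (F : Feasible ident T H E Q P A L ω ρ) : 0 < L.hop := by
  rw [F.hop_eq]; exact Nat.succ_pos _

lemma heard_ident (F : Feasible ident T H E Q P A L ω ρ) (t : ℕ) (u v : V) :
    hrd v t (ident u) =
      if G.Adj u v then L.emit (W u) (ρ u) t (hrd u) (ident v) else none :=
  heard_historyMachine G ident (fun v => L.emit (W v) (ρ v)) (fun v => L.result (W v) (ρ v))
    F.injective (fun _ _ _ _ _ h => Plan.emit_congr F.hop_pos _ _ h) t u v

lemma localView_parent_root : (W T.root).parent = none := if_pos rfl

lemma localView_parent {v : V} (hv : v ≠ T.root) :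
    (W v).parent = some (ident (T.parent v)) := if_neg hv

/-- The root repeats a coefficient for `hop` rounds and every other vertex repeats what its parent
sent one round earlier, so depth `d` lags behind the root by `d` rounds. -/
lemma emit_broadcast (F : Feasible ident T H E Q P A L ω ρ) (v : V) {t : ℕ}
    (hvt : G.dist T.root v ≤ t) (ht : t < L.seedTime) (q : ℕ) :
    L.emit (W v) (ρ v) t (hrd v) q =
      some (digit L.modulus (ρ T.root) ((t - G.dist T.root v) / L.hop)).bits := by
  induction hd : G.dist T.root v generalizing v t q with
  | zero =>
    obtain rfl := T.eq_root_of_dist_eq_zero hd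
    rw [Plan.emit, if_pos ht, Plan.forward, localView_parent_root]
    exact bounded_eq_some.2 ⟨rfl, F.seed_width _⟩
  | succ d ih =>
    have hv : v ≠ T.root := by rintro rfl; simp at hd
    have hd' : G.dist T.root (T.parent v) = d := by rw [T.dist_parent_eq, hd]; rfl
    rw [Plan.emit, if_pos ht, Plan.forward, localView_parent hv]
    simp only
    rw [if_neg (by omega), F.heard_ident, if_pos (T.adj_parent v hv).symm,
      ih (T.parent v) (by omega) (by omega) _ hd', show t - 1 - d = t - (d + 1) by omega]
    exact bounded_eq_some.2 ⟨rfl, F.seed_width _⟩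

/-- Coefficient `l` is read in the last round of the root's block `l`. The parent lags by less than
the depth, and `hop` is the depth plus one, so what it sends then still belongs to this block. -/
lemma learned_eq (F : Feasible ident T H E Q P A L ω ρ) (v : V) {l : ℕ} (hl : l < L.slots) :
    L.learned (W v) (ρ v) (hrd v) l = digit L.modulus (ρ T.root) l := by
  by_cases hv : v = T.root
  · subst hv; rw [Plan.learned, localView_parent_root]
  · rw [Plan.learned, localView_parent hv]
    have hd := T.dist_parent v hv
    have hdep := T.dist_le_depth v
    have hhop := F.hop_eq
    have h1 : (l + 1) * L.hop ≤ L.slots * L.hop := Nat.mul_le_mul_right _ hl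
    have h2 : (l + 1) * L.hop = l * L.hop + L.hop := by ring
    simp only
    rw [F.heard_ident, if_pos (T.adj_parent v hv).symm,
      F.emit_broadcast _ (by omega) (by unfold Plan.seedTime; omega), Option.getD_some,
      ofBits_bits, Nat.div_eq_of_lt_le (k := l) (by omega) (by rw [h2]; omega)]

lemma delay_eq (F : Feasible ident T H E Q P A L ω ρ) (v : V) (i : ℕ × ℕ) :
    L.delay (W v) (ρ v) (hrd v) i =
      seedDelay L.modulus L.slots L.delays (ρ T.root) (L.key i) := by
  simp only [Plan.delay, seedDelay, polyHash]
  rw [Finset.sum_congr rfl fun l hl => by rw [F.learned_eq v (Finset.mem_range.1 hl)]]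

variable (ident T H E Q P A L ω ρ) in
/-- The simulated states in phase `k` are the states in the single executions. -/
def CorrectAt (k : ℕ) : Prop :=
  ∀ p ∈ Q, ∀ v, Involved (T.allowedEdges H E (P p.1 p.2)) v → ∀ r ≤ (A p).rounds, dly p + r = k →
    L.simState ⟨(A p).rounds, (A p).node ω v⟩ (dly p) (ident p.1, ident p.2) (hrd v) r =
      stateAt G ident ((A p).node ω) r v

/-- A vertex that sends a message in a solo run is involved, since the edge is an allowed one; so it
holds the program and simulates it. -/
lemma outgoing_eq_some (F : Feasible ident T H E Q P A L ω ρ) {k : ℕ}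
    (hk : CorrectAt ident T H E Q P A L ω ρ k) {u v : V} (huv : G.Adj u v) (i : ℕ × ℕ) (m : Msg) :
    L.outgoing (W u) (ρ u) (hrd u) k (ident v) i = some m ↔
      ∃ p ∈ Q, (ident p.1, ident p.2) = i ∧ dly p ≤ k ∧ k < dly p + (A p).rounds ∧
        sent G ident ((A p).node ω) (k - dly p) u v = some m := by
  have hsent : ∀ (p : V × V) (r : ℕ), sent G ident ((A p).node ω) r u v =
      ((A p).node ω u).send (stateAt G ident ((A p).node ω) r u) (ident v) :=
    fun p r => if_pos huv
  constructor
  · intro h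
    obtain ⟨J, hJ, h⟩ := Option.bind_eq_some_iff.1 h
    obtain ⟨p, hp, rfl, hinv, rfl⟩ := exists_of_localView_jobs ident T H E Q P A ω hJ
    rw [F.delay_eq] at h
    split_ifs at h with hc
    refine ⟨p, hp, rfl, hc.1, hc.2, ?_⟩
    have hc1 : dly p ≤ k := hc.1
    have hc2 : k < dly p + (A p).rounds := hc.2
    have hS := hk p hp u hinv (k - dly p) (by omega) (by omega)
    rw [hsent, ← hS]
    exact h
  · rintro ⟨p, hp, rfl, h1, h2, h3⟩
    have hinv : Involved (T.allowedEdges H E (P p.1 p.2)) u :=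
      ⟨s(u, v), F.allowed p hp (k - dly p) (by omega) u v (by simp [h3]), Sym2.mem_mk_left _ _⟩
    have hS := hk p hp u hinv (k - dly p) (by omega) (by omega)
    refine Option.bind_eq_some_iff.2 ⟨_, localView_jobs T H E ω F.injective hp hinv, ?_⟩
    rw [F.delay_eq, if_pos ⟨h1, h2⟩]
    rw [hsent, ← hS] at h3
    exact h3

lemma collect_heard (F : Feasible ident T H E Q P A L ω ρ) {k : ℕ} (hkL : k < L.phases)
    (hk : CorrectAt ident T H E Q P A L ω ρ k) {u v : V} (huv : G.Adj u v) (i : ℕ × ℕ) :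
    collect L.slots (fun s => hrd v (L.seedTime + k * L.slots + s) (ident u)) i =
      L.outgoing (W u) (ρ u) (hrd u) k (ident v) i := by
  have h1 : ∀ s < L.slots, hrd v (L.seedTime + k * L.slots + s) (ident u) =
      bounded L.width (slotMsg (L.outgoing (W u) (ρ u) (hrd u) k (ident v)) s) := by
    intro s hs
    have hpos : 0 < L.slots := by omega
    rw [F.heard_ident, if_pos huv, Plan.emit, if_neg (by omega),
      show L.seedTime + k * L.slots + s - L.seedTime = s + k * L.slots by omega,
      Nat.add_mul_div_right _ _ hpos, Nat.div_eq_of_lt hs, zero_add, Nat.add_mul_mod_self_right,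
      Nat.mod_eq_of_lt hs]
  rw [Plan.collect_congr h1]
  -- The tags in use belong to pairs active on this edge, of which there are at most `slots`.
  refine collect_slotMsg (F := (Q.filter fun p =>
    ActiveAt (G := G) ident A L ω (ρ T.root) p k u v).image fun p => (ident p.1, ident p.2))
    (fun j hj => ?_) (Finset.card_image_le.trans (F.uncongested u v huv k hkL)) (fun j m hj => ?_) i
  · obtain ⟨m, hm⟩ := Option.isSome_iff_exists.1 hj
    obtain ⟨p, hp, rfl, h2, h3, h4⟩ := (F.outgoing_eq_some hk huv j m).1 hm
    exact Finset.mem_image.2 ⟨p, Finset.mem_filter.2 ⟨hp, h2, h3, by simp [h4]⟩, rfl⟩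
  · obtain ⟨p, hp, rfl, h2, h3, h4⟩ := (F.outgoing_eq_some hk huv j m).1 hj
    exact F.job_width p hp _ (by omega) u v m h4

/-- Induction on the phase, for all pairs at once: correct states in phase `k` give correct messages
in phase `k`, and these give correct states in phase `k + 1`. -/
lemma correctAt (F : Feasible ident T H E Q P A L ω ρ) (k : ℕ) (hkL : k ≤ L.phases) :
    CorrectAt ident T H E Q P A L ω ρ k := by
  induction k with
  | zero =>
    intro p hp v hv r hr hrk
    obtain rfl : r = 0 := by omega
    rfl
  | succ k ih =>
    have ih := ih (by omega)
    intro p hp v hv r hr hrk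
    cases r with
    | zero => rfl
    | succ r =>
      obtain rfl : k = dly p + r := by omega
      have hS := ih p hp v hv r (by omega) rfl
      rw [Plan.simState, stateAt, hS]
      change ((A p).node ω v).receive _ _ = _
      congr 1
      funext q
      by_cases hq : ∃ u, ident u = q
      · obtain ⟨u, rfl⟩ := hq
        rw [inbox_ident G ident F.injective]
        by_cases huv : G.Adj u v
        · rw [F.collect_heard (by omega) ih huv]
          refine Option.ext fun m => ?_
          rw [F.outgoing_eq_some ih huv]
          constructor
          -- Identifiers are distinct, so the tag rules out messages of other algorithms.
          · rintro ⟨p', -, h1, -, -, h4⟩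
            obtain rfl : p' = p := Prod.ext (F.injective (congrArg Prod.fst h1))
              (F.injective (congrArg Prod.snd h1))
            rwa [Nat.add_sub_cancel_left] at h4
          · intro h
            exact ⟨p, hp, rfl, by omega, by omega, by rwa [Nat.add_sub_cancel_left]⟩
        · rw [messageFrom, if_neg huv]
          simp only [F.heard_ident, if_neg huv, collect_none]
      · have hq : ∀ u, ident u ≠ q := fun u hu => hq ⟨u, hu⟩
        rw [inbox_of_notMem G ident _ _ _ hq]
        simp only [heard, inbox_of_notMem G ident _ _ _ hq, collect_none]

/-- Under these conditions the simultaneous execution ends with the outputs of the single ones. -/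
theorem outputAt_eq (F : Feasible ident T H E Q P A L ω ρ) {p : V × V} (hp : p ∈ Q) {v : V}
    (hv : Involved (T.allowedEdges H E (P p.1 p.2)) v) :
    outputAt G ident (planMachines ident T H E Q P A L ω ρ) L.endTime v (ident p.1) (ident p.2) =
      some ((A p).soloOutput G ident ω v) := by
  have hst := stateAt_historyMachine G ident (fun v => L.emit (W v) (ρ v))
    (fun v => L.result (W v) (ρ v)) L.endTime v
  have hJ := localView_jobs (A := A) T H E ω F.injective hp hv
  have hfit := F.delay_add_rounds_le p hp
  have hmul : (dly p + (A p).rounds) * L.slots ≤ L.phases * L.slots :=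
    Nat.mul_le_mul_right _ hfit
  have hdelay : L.delay (W v) (ρ v) (hrd v) (ident p.1, ident p.2) = dly p := F.delay_eq v _
  change L.result (W v) (ρ v) (stateAt G ident (fun v => historyMachine (L.emit (W v) (ρ v))
    (L.result (W v) (ρ v))) L.endTime v).2 _ _ = _
  rw [hst]
  rw [Plan.result_congr (h' := hrd v) F.hop_pos]
  · have hS := F.correctAt _ hfit p hp v hv _ le_rfl rfl
    rw [Plan.result, hJ, Option.map_some, hdelay, hS]
    rfl
  · intro τ hτ
    exact if_pos (by unfold Plan.endTime; omega)
  · intro J hJ' τ hτ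
    obtain rfl : (⟨(A p).rounds, (A p).node ω v⟩ : Job) = J := Option.some.inj (hJ.symm.trans hJ')
    rw [hdelay] at hτ
    exact if_pos (by unfold Plan.endTime; simp only at hτ; omega)

end Feasible

end Correctness

/-! ### Uniform probability -/

section Probability

variable {X Y : Type}

lemma prob_nonneg (E : X → Prop) : 0 ≤ prob E := by unfold prob; positivity

lemma prob_equiv (e : X ≃ Y) (E : Y → Prop) : prob (fun x => E (e x)) = prob E := by
  rw [prob, prob, Nat.card_congr e,
    Nat.card_congr (e.subtypeEquiv (p := fun x => E (e x)) (q := E) fun _ => Iff.rfl)]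

lemma prob_fst [Finite Y] [Nonempty Y] (E : X → Prop) :
    prob (fun o : X × Y => E o.1) = prob E := by
  have hY : (Nat.card Y : ℝ) ≠ 0 := by exact_mod_cast Nat.card_pos.ne'
  rw [prob, prob, Nat.card_congr (Equiv.prodSubtypeFstEquivSubtypeProd (p := E)), Nat.card_prod,
    Nat.card_prod, Nat.cast_mul, Nat.cast_mul, mul_div_mul_right _ _ hY]

/-- Used to pass from the coins of all vertices to that of the root, which alone determines the
delays. -/
lemma prob_apply {V : Type} [Finite V] [Finite X] [Nonempty X] (v : V) (E : X → Prop) :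
    prob (fun f : V → X => E (f v)) = prob E := by
  rw [← prob_fst (Y := { j // j ≠ v } → X) E]
  exact prob_equiv (Equiv.funSplitAt v X) fun o => E o.1

lemma prob_or_le (E F : X → Prop) : prob (fun x => E x ∨ F x) ≤ prob E + prob F := by
  unfold prob
  rw [← add_div]
  gcongr
  have := Set.ncard_union_le {x | E x} {x | F x}
  exact_mod_cast this

lemma prob_exists_mem_le {ι : Type} (s : Finset ι) (E : ι → X → Prop) {c : ℝ}
    (h : ∀ i ∈ s, prob (E i) ≤ c) : prob (fun x => ∃ i ∈ s, E i x) ≤ s.card * c := by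
  induction s using Finset.induction_on with
  | empty => simp [prob]
  | insert i s hi ih =>
    simp only [Finset.exists_mem_insert]
    rw [Finset.card_insert_of_notMem hi, Nat.cast_add, Nat.cast_one, add_mul, one_mul, add_comm]
    exact (prob_or_le _ _).trans (add_le_add (h i (Finset.mem_insert_self _ _))
      (ih fun j hj => h j (Finset.mem_insert_of_mem hj)))

variable [Finite X]

lemma prob_mono {E F : X → Prop} (h : ∀ x, E x → F x) : prob E ≤ prob F := by
  unfold prob
  gcongr
  exact Nat.card_le_card_of_injective (Subtype.map id h) (Subtype.map_injective _ fun _ _ => id)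

variable [Nonempty X]

lemma prob_not (E : X → Prop) : prob (fun x => ¬ E x) = 1 - prob E := by
  have hX : (Nat.card X : ℝ) ≠ 0 := by exact_mod_cast Nat.card_pos.ne'
  have h : (Nat.card {x // E x} : ℝ) + Nat.card {x // ¬ E x} = Nat.card X := by
    exact_mod_cast Set.ncard_add_ncard_compl {x | E x}
  rw [prob, prob, eq_sub_iff_add_eq, ← add_div, add_comm, h, div_self hX]

lemma prob_prod_le [Finite Y] [Nonempty Y] (E : X → Y → Prop) {c : ℝ}
    (h : ∀ x, prob (E x) ≤ c) : prob (fun o : X × Y => E o.1 o.2) ≤ c := by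
  have := Fintype.ofFinite X
  have hX : (0 : ℝ) < Nat.card X := by exact_mod_cast Nat.card_pos
  have hY : (0 : ℝ) < Nat.card Y := by exact_mod_cast Nat.card_pos
  rw [prob, Nat.card_congr (Equiv.subtypeProdEquivSigmaSubtype E), Nat.card_sigma, Nat.card_prod,
    Nat.cast_mul, div_le_iff₀ (mul_pos hX hY), Nat.cast_sum]
  calc _ ≤ ∑ _x : X, c * Nat.card Y := Finset.sum_le_sum fun x _ => by
        have := h x
        rwa [prob, div_le_iff₀ hY] at this
    _ = _ := by
        rw [Finset.sum_const, Finset.card_univ, nsmul_eq_mul, Nat.card_eq_fintype_card (α := X)]; ring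

end Probability

/-! ### The parameters -/

lemma one_le_lg (n : ℕ) : 1 ≤ lg n := Nat.succ_le_succ (Nat.zero_le _)

lemma lt_two_pow_lg (n : ℕ) : n < 2 ^ lg n := Nat.lt_pow_succ_log_self (by norm_num) n

lemma softO_mono {a a' D D' : ℕ} (n : ℕ) (ha : a ≤ a') (hD : D ≤ D') :
    softO a n D ≤ softO a' n D' :=
  Nat.mul_le_mul (Nat.mul_le_mul ha hD) (Nat.pow_le_pow_right (one_le_lg n) ha)

lemma BFSTree.depth_le_card {V : Type} [Fintype V] {G : SimpleGraph V} (T : BFSTree G)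
    (hG : G.Connected) : T.depth ≤ Fintype.card V :=
  Finset.sup_le fun v _ => by
    obtain ⟨p, hp⟩ := (hG T.root v).exists_isPath
    exact (SimpleGraph.dist_le p).trans hp.length_lt.le

/-- The constant in the number of algorithms that use an edge. -/
def loadConst (a : ℕ) : ℕ := 2 * a + 12

/-- The constant in the number of delays. -/
def delayConst (a : ℕ) : ℕ := 4 * loadConst a ^ 2

/-- The constant in the number of messages that can be sent through an edge in a phase. -/
def slotConst (a k : ℕ) : ℕ := 2 * delayConst a + k + 5

/-- The constant in the length of the messages. -/
def widthConst (a : ℕ) : ℕ := 7 * a + 2 * delayConst a + 4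

/-- The number of different delays. -/
def delayRange (a n d : ℕ) : ℕ := softO (delayConst a) n d

/-- The modulus of the hash function. -/
def hashPrime (a n d : ℕ) : ℕ :=
  Nat.find (Nat.exists_infinite_primes (n ^ (2 * a) * delayRange a n d + 1))

/-- The parameters of the simultaneous execution for `n` vertices and a tree of depth `d`. -/
def plan (a k n d : ℕ) : Plan where
  slots := slotConst a k * lg n
  hop := d + 1
  modulus := hashPrime a n d
  base := n ^ a
  delays := delayRange a n d
  phases := 2 * delayRange a n d
  width := widthConst a * lg n

/-- The algorithm that executes all given algorithms with random delays. -/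
def scheduler (a k : ℕ) : Scheduler where
  range n d := hashPrime a n d ^ (slotConst a k * lg n) - 1
  rounds n d := if d = 0 then 0 else (plan a k n d).endTime
  node W x := (plan a k W.n W.depth).machine W x

/-! ### Estimates for the parameters -/

variable {a k n d : ℕ}

lemma hashPrime_prime : (hashPrime a n d).Prime :=
  (Nat.find_spec (Nat.exists_infinite_primes (n ^ (2 * a) * delayRange a n d + 1))).2

/-- The modulus has to exceed the keys, to keep them distinct, and the number of delays, to make
reduction nearly uniform. -/
lemma lt_hashPrime : n ^ (2 * a) * delayRange a n d < hashPrime a n d :=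
  (Nat.find_spec (Nat.exists_infinite_primes (n ^ (2 * a) * delayRange a n d + 1))).1

/-- Bertrand's postulate; it keeps the coefficients within O(log n) bits. -/
lemma hashPrime_le (h : n ^ (2 * a) * delayRange a n d ≠ 0) :
    hashPrime a n d ≤ 2 * (n ^ (2 * a) * delayRange a n d) := by
  obtain ⟨p, hp, h1, h2⟩ := Nat.exists_prime_lt_and_le_two_mul _ h
  exact (Nat.find_min' _ ⟨h1, hp⟩).trans h2

lemma scheduler_range_succ :
    (scheduler a k).range n d + 1 = hashPrime a n d ^ (slotConst a k * lg n) :=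
  Nat.sub_add_cancel (Nat.pow_pos hashPrime_prime.pos)

lemma delayRange_pos (hd : 0 < d) : 0 < delayRange a n d := by
  unfold delayRange softO delayConst loadConst
  have := one_le_lg n
  positivity

lemma delayRange_le (hdn : d ≤ n) : delayRange a n d ≤ 2 ^ ((2 * delayConst a + 1) * lg n) := by
  have h1 : delayConst a ≤ 2 ^ (delayConst a * lg n) :=
    Nat.lt_two_pow_self.le.trans (Nat.pow_le_pow_right (by norm_num)
      (Nat.le_mul_of_pos_right _ (one_le_lg n)))
  have h2 : d ≤ 2 ^ lg n := hdn.trans (lt_two_pow_lg n).le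
  have h3 : lg n ^ delayConst a ≤ 2 ^ (lg n * delayConst a) := by
    rw [pow_mul]; exact Nat.pow_le_pow_left Nat.lt_two_pow_self.le _
  calc _ ≤ 2 ^ (delayConst a * lg n) * 2 ^ lg n * 2 ^ (lg n * delayConst a) :=
        Nat.mul_le_mul (Nat.mul_le_mul h1 h2) h3
    _ = _ := by rw [← pow_add, ← pow_add]; congr 1; ring

lemma hashPrime_lt (hn : 0 < n) (hd : 0 < d) (hdn : d ≤ n) :
    hashPrime a n d ≤ 2 ^ (widthConst a * lg n) := by
  have h1 : n ^ (2 * a) ≤ 2 ^ (2 * a * lg n) := by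
    rw [mul_comm (2 * a), pow_mul 2]; exact Nat.pow_le_pow_left (lt_two_pow_lg n).le _
  have h2 : 2 ≤ 2 ^ lg n := Nat.le_self_pow (Nat.succ_ne_zero _) 2
  calc _ ≤ 2 * (n ^ (2 * a) * delayRange a n d) :=
        hashPrime_le (Nat.mul_pos (Nat.pow_pos hn) (delayRange_pos hd)).ne'
    _ ≤ 2 ^ lg n * (2 ^ (2 * a * lg n) * 2 ^ ((2 * delayConst a + 1) * lg n)) :=
        Nat.mul_le_mul h2 (Nat.mul_le_mul h1 (delayRange_le hdn))
    _ = 2 ^ ((2 * a + 2 * delayConst a + 2) * lg n) := by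
        rw [← pow_add, ← pow_add]; congr 1; ring
    _ ≤ _ := Nat.pow_le_pow_right (by norm_num) (Nat.mul_le_mul_right _
        (by unfold widthConst; omega))

/-- Here `2 * d` bounds the diameter, and `d + 2 ≤ 3 * d` gives the 12 in `loadConst`. -/
lemma load_le (hd : 0 < d) :
    softO a n (2 * d) + 4 * (lg n * (d + 2)) ≤ softO (loadConst a) n d := by
  have hl := one_le_lg n
  have h1 : lg n ^ a ≤ lg n ^ loadConst a :=
    Nat.pow_le_pow_right hl (by unfold loadConst; omega)
  have h2 : lg n ≤ lg n ^ loadConst a := Nat.le_self_pow (by unfold loadConst; omega) _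
  calc _ = 2 * a * d * lg n ^ a + 4 * (d + 2) * lg n := by unfold softO; ring
    _ ≤ 2 * a * d * lg n ^ loadConst a + 12 * d * lg n ^ loadConst a :=
        Nat.add_le_add (Nat.mul_le_mul_left _ h1) (Nat.mul_le_mul (by omega) h2)
    _ = _ := by unfold softO; conv_rhs => enter [1]; unfold loadConst
                ring

/-- The condition R ≥ 4gC. As `softO` uses its constant also as exponent, `delayConst` must dominate
both four times the product of the constants and the sum of the exponents. -/
lemma congestion_mul_load_le :
    4 * (softO a n 1 * softO (loadConst a) n d) ≤ delayRange a n d := by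
  have hl := one_le_lg n
  have ha : a ≤ loadConst a := by unfold loadConst; omega
  have hc : loadConst a + loadConst a ≤ delayConst a := by
    unfold delayConst; have : 12 ≤ loadConst a := by unfold loadConst; omega
    nlinarith
  calc _ ≤ 4 * (softO (loadConst a) n 1 * softO (loadConst a) n d) := by
        gcongr; exact softO_mono n ha le_rfl
    _ = delayConst a * d * lg n ^ (loadConst a + loadConst a) := by
        unfold softO; conv_rhs => enter [1]; unfold delayConst
        ring
    _ ≤ _ := Nat.mul_le_mul_left _ (Nat.pow_le_pow_right hl hc)

lemma endTime_le (hd : 0 < d) :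
    (plan a k n d).endTime ≤ softO (2 * slotConst a k * (delayConst a + 1)) n d := by
  have hl := one_le_lg n
  have hs : 1 ≤ slotConst a k := by unfold slotConst; omega
  have h1 : lg n ≤ lg n ^ (delayConst a + 1) := Nat.le_self_pow (by omega) _
  have h2 : delayConst a + 1 ≤ 2 * slotConst a k * (delayConst a + 1) :=
    Nat.le_mul_of_pos_left _ (by omega)
  calc _ = slotConst a k * (d + 1) * lg n
        + 2 * slotConst a k * delayConst a * d * lg n ^ (delayConst a + 1) := by
        simp only [Plan.endTime, Plan.seedTime, plan, delayRange, softO]; ring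
    _ ≤ slotConst a k * (2 * d) * lg n ^ (delayConst a + 1)
        + 2 * slotConst a k * delayConst a * d * lg n ^ (delayConst a + 1) :=
        Nat.add_le_add_right (Nat.mul_le_mul (Nat.mul_le_mul_left _ (by omega)) h1) _
    _ = 2 * slotConst a k * (delayConst a + 1) * d * lg n ^ (delayConst a + 1) := by ring
    _ ≤ _ := Nat.mul_le_mul_left _ (Nat.pow_le_pow_right hl h2)

/-- The exponents of `2 ^ lg n` sum to `slotConst`: 2 for directed edges, `2 * delayConst a + 2` for
phases, `k + 1` for the failure probability. -/
lemma union_bound_le (hdn : d ≤ n) :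
    n ^ 2 * (2 * delayRange a n d) * n ^ (k + 1) ≤ 2 ^ (slotConst a k * lg n) := by
  have h0 := (lt_two_pow_lg n).le
  have h2 : 2 ≤ 2 ^ lg n := Nat.le_self_pow (Nat.succ_ne_zero _) 2
  calc _ ≤ (2 ^ lg n) ^ 2 * (2 ^ lg n * 2 ^ ((2 * delayConst a + 1) * lg n))
        * (2 ^ lg n) ^ (k + 1) := by
        gcongr
        exact delayRange_le hdn
    _ = _ := by
        rw [← pow_mul, ← pow_mul, ← pow_add, ← pow_add, ← pow_add]
        congr 1
        unfold slotConst
        ring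

/-! ### Analysis of the scheduler -/

section Analysis

variable {V : Type} [Fintype V] {Ω : Type} {G : SimpleGraph V} {ident : V → ℕ} {T : BFSTree G}
  {H : T.HeavyChoice} {E : T.ConnectingEdges} {a : ℕ} {Q : Finset (V × V)}
  {P : (x y : V) → G.Path x y} {A : V × V → Protocol V Ω}

/-- In no phase more messages have to be sent through an edge than there are slots. -/
def Uncongested (ident : V → ℕ) (Q : Finset (V × V)) (A : V × V → Protocol V Ω) (G : SimpleGraph V)
    (L : Plan) (ω : Ω) (x : ℕ) : Prop :=
  ∀ u v, G.Adj u v → ∀ j < L.phases,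
    (Q.filter fun p => ActiveAt (G := G) ident A L ω x p j u v).card ≤ L.slots

lemma rounds_le_delayRange {n D d r : ℕ} (hd : 0 < d) (hD : D ≤ 2 * d) (h : r ≤ softO a n D) :
    r ≤ delayRange a n d := by
  have h1 : loadConst a ≤ delayConst a := by
    unfold delayConst; have : 12 ≤ loadConst a := by unfold loadConst; omega
    nlinarith
  exact (h.trans (softO_mono n le_rfl hD)).trans
    ((Nat.le_add_right _ _).trans ((load_le hd).trans (softO_mono n h1 le_rfl)))

lemma feasible (hG : G.Connected) (hid : Function.Injective ident)
    (hlt : ∀ v, ident v < Fintype.card V ^ a)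
    (hA : ∀ p ∈ Q, IsPairAlgorithm ident T H E a (P p.1 p.2) (A p)) (hd : 0 < T.depth) {k : ℕ}
    {ω : Ω} {ρ : V → ℕ}
    (hρ : Uncongested ident Q A G (plan a k (Fintype.card V) T.depth) ω (ρ T.root)) :
    Feasible ident T H E Q P A (plan a k (Fintype.card V) T.depth) ω ρ where
  injective := hid
  hop_eq := rfl
  seed_width l := by
    have := hG.nonempty
    rw [Nat.size_eq_bits_len, Nat.size_le]
    exact (Nat.mod_lt _ hashPrime_prime.pos).trans_le
      (hashPrime_lt Fintype.card_pos hd (T.depth_le_card hG))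
  job_width p hp t ht u v m hm := by
    have hs : ∀ v, (ident v).size ≤ a * lg (Fintype.card V) := fun v => by
      rw [Nat.size_le, mul_comm, pow_mul]
      exact (hlt v).trans_le (Nat.pow_le_pow_left (lt_two_pow_lg _).le _)
    have h1 := hs p.1
    have h2 := hs p.2
    have h3 := (hA p hp).bandwidth ω t ht u v m hm
    have h4 := one_le_lg (Fintype.card V)
    -- Each of the two identifiers takes `2 * a * lg n` bits, the message `a * lg n`, the end marks
    -- 2.
    have h5 : (5 * a + 2) * lg (Fintype.card V) ≤ widthConst a * lg (Fintype.card V) :=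
      Nat.mul_le_mul_right _ (by unfold widthConst; omega)
    rw [length_pack]
    refine le_trans ?_ h5
    simp only
    rw [add_mul, mul_assoc]
    omega
  allowed p hp := (hA p hp).allowed ω
  delay_add_rounds_le p hp := by
    have h1 : pairDelay ident (plan a k (Fintype.card V) T.depth) (ρ T.root) p <
        delayRange a (Fintype.card V) T.depth := Nat.mod_lt _ (delayRange_pos hd)
    have h2 := rounds_le_delayRange hd (T.diam_le_two_mul_depth hG) (hA p hp).rounds_le
    have h3 : (plan a k (Fintype.card V) T.depth).phases =
      2 * delayRange a (Fintype.card V) T.depth := rfl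
    omega
  uncongested := hρ

/-! ### The probability of congestion -/

lemma card_seeds_congested_at_le (hG : G.Connected) (hid : Function.Injective ident)
    (hlt : ∀ v, ident v < Fintype.card V ^ a) (hP : Promise G a Q P)
    (hA : ∀ p ∈ Q, IsPairAlgorithm ident T H E a (P p.1 p.2) (A p)) (hd : 0 < T.depth) (k : ℕ)
    (ω : Ω) {u v : V} (huv : G.Adj u v) (j : ℕ) :
    let L := plan a k (Fintype.card V) T.depth
    2 ^ L.slots * ((Finset.range (L.modulus ^ L.slots)).filter fun x =>
      L.slots ≤ (Q.filter fun p => ActiveAt (G := G) ident A L ω x p j u v).card).card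
      ≤ L.modulus ^ L.slots := by
  intro L
  set n := Fintype.card V with hn
  set K := Q.filter fun p => s(u, v) ∈ T.allowedEdges H E (P p.1 p.2) with hK
  set B : V × V → Finset ℕ := fun p => (Finset.range (j + 1)).filter fun δ =>
    j < δ + (A p).rounds ∧ (sent G ident ((A p).node ω) (j - δ) u v).isSome with hB
  have hR := delayRange_pos (a := a) (n := n) hd
  have hbase : L.base = n ^ a := rfl
  have hkey : ∀ p : V × V, L.key (ident p.1, ident p.2) < L.modulus := fun p => by
    have h1 := hlt p.1
    have h2 := hlt p.2
    refine lt_of_lt_of_le ?_ (lt_hashPrime (a := a) (n := n) (d := T.depth)).le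
    refine lt_of_lt_of_le ?_ (Nat.le_mul_of_pos_right _ hR)
    simp only [Plan.key, hbase]
    rw [two_mul, pow_add]
    calc _ < ident p.1 * n ^ a + n ^ a := by omega
      _ = (ident p.1 + 1) * n ^ a := by ring
      _ ≤ _ := Nat.mul_le_mul_right _ h1
  -- The two identifiers are the digits of the key in base `n ^ a`.
  have hinj : Set.InjOn (fun p : V × V => L.key (ident p.1, ident p.2)) K := by
    intro p _ q _ hpq
    have hp := hlt p.2
    have hq := hlt q.2
    have hpos : 0 < n ^ a := by omega
    simp only [Plan.key, hbase] at hpq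
    rw [mul_comm, mul_comm (ident q.1)] at hpq
    have h1 := congrArg (· / n ^ a) hpq
    have h2 := congrArg (· % n ^ a) hpq
    simp only [Nat.mul_add_mod, Nat.mod_eq_of_lt hp, Nat.mod_eq_of_lt hq] at h2
    simp only [Nat.mul_add_div hpos, Nat.div_eq_of_lt hp, Nat.div_eq_of_lt hq,
      add_zero] at h1
    exact Prod.ext (hid h1) (hid h2)
  have hKcard : K.card ≤ softO (loadConst a) n T.depth :=
    (T.card_filter_mem_allowedEdges_le H E hP (e := s(u, v)) huv).trans
      ((Nat.add_le_add_right (softO_mono n le_rfl (T.diam_le_two_mul_depth hG)) _).trans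
        (load_le hd))
  -- Different delays put different rounds of the solo run into phase `j`, and each of these rounds
  -- sends a message from `u` to `v`.
  have hBcard : ∀ p ∈ K, (B p).card ≤ softO a n 1 := by
    intro p hp
    refine le_trans ?_ ((Nat.le_add_right _ _).trans
      ((hA p (Finset.mem_filter.1 hp).1).congestion ω u v huv))
    refine Finset.card_le_card_of_injOn (fun δ => j - δ) (fun δ hδ => ?_) fun δ hδ δ' hδ' h => ?_
    · obtain ⟨h1, h2, h3⟩ := Finset.mem_filter.1 hδ
      rw [Finset.mem_range] at h1
      exact Finset.mem_filter.2 ⟨Finset.mem_range.2 (by simp only; omega), h3⟩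
    · have h1 := Finset.mem_range.1 (Finset.mem_filter.1 hδ).1
      have h2 := Finset.mem_range.1 (Finset.mem_filter.1 hδ').1
      simp only at h
      omega
  have hRp : delayRange a n T.depth ≤ L.modulus := by
    have hn0 : 0 < n := by have := hG.nonempty; exact Fintype.card_pos
    exact (Nat.le_mul_of_pos_left _ (Nat.pow_pos hn0)).trans lt_hashPrime.le
  refine le_trans (Nat.mul_le_mul_left _ (Finset.card_le_card fun x hx => ?_))
    (card_congested_seeds_le hashPrime_prime hRp congestion_mul_load_le hKcard hinj
      (fun p _ => hkey p) B hBcard)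
  obtain ⟨hx1, hx2⟩ := Finset.mem_filter.1 hx
  refine Finset.mem_filter.2 ⟨hx1, hx2.trans (Finset.card_le_card fun p hp => ?_)⟩
  obtain ⟨hpQ, h1, h2, h3⟩ := Finset.mem_filter.1 hp
  refine Finset.mem_filter.2 ⟨Finset.mem_filter.2 ⟨hpQ, ?_⟩, Finset.mem_filter.2
    ⟨Finset.mem_range.2 (Nat.lt_succ_of_le h1), h2, h3⟩⟩
  exact (hA p hpQ).allowed ω _ (by omega) u v h3

lemma card_congested_mul_le (hG : G.Connected) (hid : Function.Injective ident)
    (hlt : ∀ v, ident v < Fintype.card V ^ a) (hP : Promise G a Q P)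
    (hA : ∀ p ∈ Q, IsPairAlgorithm ident T H E a (P p.1 p.2) (A p)) (hd : 0 < T.depth) (k : ℕ)
    (ω : Ω) :
    let L := plan a k (Fintype.card V) T.depth
    ((Finset.range (L.modulus ^ L.slots)).filter fun x => ¬ Uncongested ident Q A G L ω x).card
      * Fintype.card V ^ (k + 1) ≤ L.modulus ^ L.slots := by
  intro L
  set n := Fintype.card V with hn
  set bad : V × V → ℕ → Finset ℕ := fun e j => (Finset.range (L.modulus ^ L.slots)).filter fun x =>
    G.Adj e.1 e.2 ∧ L.slots ≤ (Q.filter fun p => ActiveAt (G := G) ident A L ω x p j e.1 e.2).card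
    with hbad
  have h1 : ((Finset.range (L.modulus ^ L.slots)).filter fun x =>
      ¬ Uncongested ident Q A G L ω x) ⊆
      ((Finset.univ : Finset (V × V)) ×ˢ Finset.range L.phases).biUnion fun i => bad i.1 i.2 := by
    intro x hx
    obtain ⟨hx1, hx2⟩ := Finset.mem_filter.1 hx
    simp only [Uncongested, not_forall, not_le] at hx2
    obtain ⟨u, v, huv, j, hj, h⟩ := hx2
    exact Finset.mem_biUnion.2 ⟨((u, v), j), by simpa using hj,
      Finset.mem_filter.2 ⟨hx1, huv, h.le⟩⟩
  have h2 : ∀ e j, 2 ^ L.slots * (bad e j).card ≤ L.modulus ^ L.slots := by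
    intro e j
    by_cases he : G.Adj e.1 e.2
    · simpa only [hbad, he, true_and] using
        card_seeds_congested_at_le hG hid hlt hP hA hd k ω he j
    · simp [hbad, he]
  have h3 : 2 ^ L.slots * ((Finset.range (L.modulus ^ L.slots)).filter fun x =>
      ¬ Uncongested ident Q A G L ω x).card ≤ n ^ 2 * L.phases * L.modulus ^ L.slots := by
    calc _ ≤ 2 ^ L.slots * ∑ i ∈ (Finset.univ : Finset (V × V)) ×ˢ Finset.range L.phases,
          (bad i.1 i.2).card :=
          Nat.mul_le_mul_left _ ((Finset.card_le_card h1).trans Finset.card_biUnion_le)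
      _ ≤ ∑ _i ∈ (Finset.univ : Finset (V × V)) ×ˢ Finset.range L.phases,
          L.modulus ^ L.slots := by
          rw [Finset.mul_sum]; exact Finset.sum_le_sum fun i _ => h2 _ _
      _ = _ := by simp [hn, sq]
  have h4 : n ^ 2 * L.phases * n ^ (k + 1) ≤ 2 ^ L.slots := union_bound_le (T.depth_le_card hG)
  refine Nat.le_of_mul_le_mul_left ?_ (Nat.pow_pos (n := L.slots) (Nat.succ_pos 1))
  calc _ = 2 ^ L.slots * ((Finset.range (L.modulus ^ L.slots)).filter fun x =>
        ¬ Uncongested ident Q A G L ω x).card * n ^ (k + 1) := by ring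
    _ ≤ n ^ 2 * L.phases * L.modulus ^ L.slots * n ^ (k + 1) := Nat.mul_le_mul_right _ h3
    _ = n ^ 2 * L.phases * n ^ (k + 1) * L.modulus ^ L.slots := by ring
    _ ≤ _ := Nat.mul_le_mul_right _ h4

/-- The exponent `k + 1` instead of `k` leaves room for the errors of the single algorithms. -/
lemma prob_not_runsAll_le (hG : G.Connected) (hid : Function.Injective ident)
    (hlt : ∀ v, ident v < Fintype.card V ^ a) (hP : Promise G a Q P)
    (hA : ∀ p ∈ Q, IsPairAlgorithm ident T H E a (P p.1 p.2) (A p)) (hd : 0 < T.depth) (k : ℕ)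
    (ω : Ω) :
    prob (fun ρ : (scheduler a k).Coins T => ¬ (scheduler a k).RunsAll ident T H E Q P A ω ρ)
      ≤ 1 / (Fintype.card V : ℝ) ^ (k + 1) := by
  have := hG.nonempty
  set L := plan a k (Fintype.card V) T.depth with hL
  set N := (scheduler a k).range (Fintype.card V) T.depth + 1 with hN
  have hNL : N = L.modulus ^ L.slots := scheduler_range_succ
  have hruns : ∀ ρ : V → Fin N, Uncongested ident Q A G L ω (ρ T.root) →
      (scheduler a k).RunsAll ident T H E Q P A ω ρ := by
    intro ρ hρ p hp v hv
    have F : Feasible ident T H E Q P A L ω fun v => ρ v := feasible hG hid hlt hA hd hρ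
    have ht : (scheduler a k).totalRounds T = L.endTime := if_neg hd.ne'
    unfold Scheduler.jointOutput
    rw [ht]
    exact F.outputAt_eq hp hv
  calc _ ≤ prob (fun ρ : V → Fin N => ¬ Uncongested ident Q A G L ω (ρ T.root)) :=
        prob_mono fun ρ h h' => h (hruns ρ h')
    _ = prob (fun x : Fin N => ¬ Uncongested ident Q A G L ω x) :=
        prob_apply T.root fun x : Fin N => ¬ Uncongested ident Q A G L ω x
    _ ≤ _ := by
        have hcard : Nat.card {x : Fin N // ¬ Uncongested ident Q A G L ω x} =
            ((Finset.range (L.modulus ^ L.slots)).filter fun x =>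
              ¬ Uncongested ident Q A G L ω x).card := by
          rw [Nat.card_eq_fintype_card, Fintype.card_subtype, ← hNL,
            ← Finset.card_map Fin.valEmbedding]
          congr 1
          ext x
          simp only [Finset.mem_map, Finset.mem_filter, Finset.mem_univ, true_and,
            Fin.valEmbedding_apply, Finset.mem_range]
          exact ⟨fun ⟨y, hy, hyx⟩ => hyx ▸ ⟨y.2, hy⟩, fun ⟨h1, h2⟩ => ⟨⟨x, h1⟩, h2, rfl⟩⟩
        have hn : (0 : ℝ) < (Fintype.card V : ℝ) ^ (k + 1) := by
          have : 0 < Fintype.card V := Fintype.card_pos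
          positivity
        have hNpos : (0 : ℝ) < N := by exact_mod_cast Nat.succ_pos _
        rw [prob, Nat.card_eq_fintype_card (α := Fin N), Fintype.card_fin, hcard,
          div_le_div_iff₀ hNpos hn, one_mul, hNL]
        exact_mod_cast card_congested_mul_le hG hid hlt hP hA hd k ω

end Analysis

/-! ### Conclusion -/

section Conclusion

variable {V : Type} {Ω : Type} {G : SimpleGraph V} {ident : V → ℕ} {T : BFSTree G}
  {H : T.HeavyChoice} {E : T.ConnectingEdges} {a : ℕ} {Q : Finset (V × V)}
  {P : (x y : V) → G.Path x y} {A : V × V → Protocol V Ω}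

/-- Independent vertices are distinct, so the channel has a first and a last edge. -/
lemma involved_endpoint (p : V × V) (hp : T.Independent p.1 p.2) {z : V}
    (hz : z = p.1 ∨ z = p.2) : Involved (T.allowedEdges H E (P p.1 p.2)) z := by
  have hnil : ¬ (P p.1 p.2 : G.Walk p.1 p.2).Nil := fun h => hp.ne h.eq
  rcases hz with rfl | rfl
  · exact ⟨_, ⟨SimpleGraph.Walk.edges_subset_edgeSet _ (SimpleGraph.Walk.mk_start_snd_mem_edges hnil),
      Or.inl (SimpleGraph.Walk.mk_start_snd_mem_edges hnil)⟩, Sym2.mem_mk_left _ _⟩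
  · exact ⟨_, ⟨SimpleGraph.Walk.edges_subset_edgeSet _
      (SimpleGraph.Walk.mk_penultimate_end_mem_edges hnil),
      Or.inl (SimpleGraph.Walk.mk_penultimate_end_mem_edges hnil)⟩, Sym2.mem_mk_right _ _⟩

variable [Fintype V]

/-- Independent pairs avoid the diagonal; the `n` thus saved pays for the failures of the scheduler.
-/
lemma card_add_card_le (hQ : ∀ p ∈ Q, T.Independent p.1 p.2) :
    Q.card + Fintype.card V ≤ Fintype.card V ^ 2 := by
  classical
  have h1 : Q ⊆ (Finset.univ : Finset V).offDiag := fun p hp => by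
    simpa using (hQ p hp).ne
  have h2 := Finset.card_le_card h1
  rw [Finset.offDiag_card, Finset.card_univ] at h2
  have h3 : Fintype.card V ≤ Fintype.card V * Fintype.card V := Nat.le_mul_self _
  rw [sq]
  omega

/-- True for all coins, even under congestion, because `Plan.emit` withholds longer messages. -/
lemma messagesAtMost_scheduler (k : ℕ) (ω : Ω) (ρ : (scheduler a k).Coins T) (r : ℕ) :
    MessagesAtMost G ident ((scheduler a k).machines ident T H E Q P A ω ρ) r
      (widthConst a * lg (Fintype.card V)) := by
  intro t _ u w m hm
  unfold sent messageFrom at hm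
  split_ifs at hm
  exact (bounded_eq_some.1 hm).2

lemma card_eq_one_of_depth_eq_zero (hd : T.depth = 0) :
    Fintype.card V = 1 := by
  have h : ∀ v, v = T.root := fun v => T.eq_root_of_dist_eq_zero (by
    have := T.dist_le_depth v; omega)
  exact Fintype.card_eq_one_iff.2 ⟨T.root, h⟩

end Conclusion

end CutPairs

end

theorem mainTheorem4 (a k : ℕ) :
    ∃ (S : CutPairs.Scheduler) (b : ℕ),
      ∀ (V : Type) [Fintype V] (G : SimpleGraph V) (ident : V → ℕ)
        (T : CutPairs.BFSTree G) (H : T.HeavyChoice) (E : T.ConnectingEdges)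
        (Q : Finset (V × V)) (P : (x y : V) → G.Path x y)
        (Ω : Type) [Finite Ω] [Nonempty Ω] (A : V × V → CutPairs.Protocol V Ω),
        G.Connected →
        Function.Injective ident →
        (∀ v, ident v < Fintype.card V ^ a) →
        (∀ p ∈ Q, T.Independent p.1 p.2) →
        CutPairs.Promise G a Q P →
        (∀ p ∈ Q, CutPairs.IsPairAlgorithm ident T H E a (P p.1 p.2) (A p)) →
        S.totalRounds T ≤ CutPairs.softO b (Fintype.card V) G.diam ∧
        (∀ ω ρ, CutPairs.MessagesAtMost G ident (S.machines ident T H E Q P A ω ρ)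
          (S.totalRounds T) (b * CutPairs.lg (Fintype.card V))) ∧
        (∀ ω, 1 - 1 / (Fintype.card V : ℝ) ^ k ≤
          CutPairs.prob fun ρ : S.Coins T => S.RunsAll ident T H E Q P A ω ρ) ∧
        ((∀ p ∈ Q, 1 - 1 / (Fintype.card V : ℝ) ^ (k + 2) ≤
            CutPairs.prob fun ω : Ω => ∀ z, (z = p.1 ∨ z = p.2) →
              (A p).soloOutput G ident ω z = CutPairs.pairAnswer G p.1 p.2) →
          1 - 1 / (Fintype.card V : ℝ) ^ k ≤
            CutPairs.prob fun o : Ω × S.Coins T =>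
              S.AnswersAll ident T H E Q P A o.1 o.2) := by
  classical
  open CutPairs in
  -- A sum, as one constant serves both the number of rounds and the message length.
  refine ⟨scheduler a k, 2 * slotConst a k * (delayConst a + 1) + widthConst a, ?_⟩
  intro V _ G ident T H E Q P Ω _ _ A hG hid hlt hQ hP hA
  refine ⟨?_, fun ω ρ t ht u w m hm => ?_, ?_⟩
  · by_cases hd : T.depth = 0
    -- At depth 0 the diameter is 0 and the bound vanishes, hence the case of zero rounds in
    -- `scheduler`.
    · exact (if_pos hd).trans_le (Nat.zero_le _)
    · exact (if_neg hd).trans_le ((endTime_le (Nat.pos_of_ne_zero hd)).trans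
        (softO_mono _ (Nat.le_add_right _ _) (T.depth_le_diam hG)))
  · exact (messagesAtMost_scheduler k ω ρ _ t ht u w m hm).trans
      (Nat.mul_le_mul_right _ (Nat.le_add_left _ _))
  · by_cases hd : T.depth = 0
    -- With a single vertex, both required probabilities are 0.
    · have hn := card_eq_one_of_depth_eq_zero hd
      simp only [hn, Nat.cast_one, one_pow, div_one, sub_self]
      exact ⟨fun _ => prob_nonneg _, fun _ => prob_nonneg _⟩
    have hd := Nat.pos_of_ne_zero hd
    have hV := hG.nonempty
    set n : ℝ := (Fintype.card V : ℝ) with hn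
    have hn1 : 1 ≤ n := by rw [hn]; exact_mod_cast (Fintype.card_pos : 0 < Fintype.card V)
    have hn0 : 0 < n := by linarith
    have hfail := prob_not_runsAll_le hG hid hlt hP hA hd k
    refine ⟨fun ω => ?_, fun hsolo => ?_⟩
    · have h1 := hfail ω
      rw [prob_not] at h1
      have h2 : 1 / n ^ (k + 1) ≤ 1 / n ^ k :=
        one_div_le_one_div_of_le (by positivity) (pow_le_pow_right₀ hn1 (Nat.le_succ k))
      linarith
    · let wrong : V × V → Ω → Prop := fun p ω => ¬ ∀ z, (z = p.1 ∨ z = p.2) →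
        (A p).soloOutput G ident ω z = pairAnswer G p.1 p.2
      have h1 : prob (fun ω => ∃ p ∈ Q, wrong p ω) ≤ Q.card * (1 / n ^ (k + 2)) :=
        prob_exists_mem_le Q wrong fun p hp => by
          rw [prob_not]; linarith [hsolo p hp]
      have h2 := prob_prod_le (Y := (scheduler a k).Coins T)
        (fun ω ρ => ¬ (scheduler a k).RunsAll ident T H E Q P A ω ρ) hfail
      -- A wrong joint answer means that some algorithm errs alone or that the joint run deviates
      -- from the solo runs.
      have h3 : prob (fun o : Ω × (scheduler a k).Coins T =>
          ¬ (scheduler a k).AnswersAll ident T H E Q P A o.1 o.2) ≤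
          Q.card * (1 / n ^ (k + 2)) + 1 / n ^ (k + 1) := by
        refine le_trans (prob_mono fun o ho => ?_) ((prob_or_le
          (fun o : Ω × (scheduler a k).Coins T => ∃ p ∈ Q, wrong p o.1)
          (fun o => ¬ (scheduler a k).RunsAll ident T H E Q P A o.1 o.2)).trans
          (add_le_add ?_ h2))
        · by_contra hcon
          simp only [wrong, not_or, not_exists, not_and, not_not] at hcon
          exact ho fun p hp z hz => (hcon.2 p hp z
            (involved_endpoint p (hQ p hp) hz)).trans (congrArg some (hcon.1 p hp z hz))
        · exact (prob_fst (Y := (scheduler a k).Coins T) fun ω => ∃ p ∈ Q, wrong p ω).trans_le h1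
      rw [prob_not] at h3
      have h4 : (Q.card : ℝ) + n ≤ n ^ 2 := by rw [hn]; exact_mod_cast card_add_card_le hQ
      -- This is `h4` divided by `n ^ (k + 2)`.
      have h5 : (Q.card : ℝ) * (1 / n ^ (k + 2)) + 1 / n ^ (k + 1) ≤ 1 / n ^ k := by
        have h6 : 1 / n ^ (k + 1) = n * (1 / n ^ (k + 2)) := by
          rw [pow_succ n (k + 1)]; field_simp
        have h7 : 1 / n ^ k = n ^ 2 * (1 / n ^ (k + 2)) := by
          rw [pow_add]; field_simp
        rw [h6, h7, ← add_mul]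
        exact mul_le_mul_of_nonneg_right h4 (by positivity)
      linarith
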